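/- For an open set $\Omega\subset\mathbb{R}^3$ let $\dot H^1(\Omega)$ be the space of real functions $\phi\in L^1_{\rm loc}(\Omega)$ whose distributional gradient in $\Omega$ satisfies $\nabla\phi\in L^2(\Omega,\mathbb{R}^3)$, and for $F\in L^2(\Omega,\mathbb{R}^3)$ put $$|||F|||_{2\Omega}:=\inf_{\phi\in\dot H^1(\Omega)}\|F-\nabla\phi\|_{L^2(\Omega,\mathbb{R}^3)} .$$ Let $A_n$ ($n\in\mathbb{N}$) and $A$ be vector fields in $L^1_{\rm loc}(\mathbb{R}^3,\mathbb{R}^3)$ whose distributional curls $\nabla\wedge A_n$ and $\nabla\wedge A$ belong to $L^{3/2}(\mathbb{R}^3,\mathbb{R}^3)$, and suppose that $\nabla\wedge A_n\rightharpoonup\nabla\wedge A$ weakly in $L^{3/2}(\mathbb{R}^3,\mathbb{R}^3)$. Then for every open set $\Omega\subset\mathbb{R}^3$ of finite measure such that $A_n-A\in L^2(\Omega,\mathbb{R}^3)$ for all $n$ (which holds automatically if $A_n,A\in L^3(\mathbb{R}^3,\mathbb{R}^3)$), $$|||A_n-A|||_{2\Omega}\to 0\qquad\text{as } n\to\infty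 .$$ -/

import Mathlib

open MeasureTheory Filter Topology
open scoped ENNReal ContDiff

/-- Euclidean three-space `ℝ³`. -/
abbrev E3 : Type := EuclideanSpace ℝ (Fin 3)

/-- `3/2` is an admissible exponent, so that `L^{3/2}` is a normed space. -/
instance fact_one_le_three_halves : Fact ((1 : ℝ≥0∞) ≤ 3 / 2) :=
  ⟨by
    rw [ENNReal.le_div_iff_mul_le (Or.inl (by norm_num)) (Or.inl (by norm_num))]
    norm_num⟩

/-- The partial derivative `∂ᵢ f (x)` of a differentiable scalar function on `ℝ³`. -/
noncomputable def partialDeriv (i : Fin 3) (f : E3 → ℝ) (x : E3) : ℝ :=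
  fderiv ℝ f x (EuclideanSpace.single i 1)

/-- The classical curl `∇ ∧ Φ` of a differentiable vector field on `ℝ³`. -/
noncomputable def curl (Φ : E3 → E3) (x : E3) : E3 :=
  !₂[partialDeriv 1 (fun y => Φ y 2) x - partialDeriv 2 (fun y => Φ y 1) x,
     partialDeriv 2 (fun y => Φ y 0) x - partialDeriv 0 (fun y => Φ y 2) x,
     partialDeriv 0 (fun y => Φ y 1) x - partialDeriv 1 (fun y => Φ y 0) x]

/-- `∇ ∧ A = B` on `ℝ³` in the sense of distributions, for (locally integrable) vector fields
`A` and `B`: `∫ A · (∇ ∧ Φ) = ∫ B · Φ` for every test field `Φ ∈ C_c^∞(ℝ³, ℝ³)`. -/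
def HasWeakCurl (A B : E3 → E3) : Prop :=
  ∀ Φ : E3 → E3, ContDiff ℝ ∞ Φ → HasCompactSupport Φ →
    ∫ x, inner ℝ (A x) (curl Φ x) = ∫ x, inner ℝ (B x) (Φ x)

/-- `∇φ = G` on the open set `Ω` in the sense of distributions: `∫_Ω φ ∂ᵢη = -∫_Ω Gᵢ η` for every
`i` and every test function `η ∈ C_c^∞(Ω)`. -/
def HasWeakGradOn (Ω : Set E3) (φ : E3 → ℝ) (G : E3 → E3) : Prop :=
  ∀ η : E3 → ℝ, ContDiff ℝ ∞ η → HasCompactSupport η → tsupport η ⊆ Ω → ∀ i : Fin 3,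
    ∫ x in Ω, φ x * partialDeriv i η x = - ∫ x in Ω, G x i * η x

/-- `φ` belongs to the homogeneous Sobolev space `Ḣ¹(Ω)`, with weak gradient `G`: `φ` is in
`L¹_loc(Ω)`, and its distributional gradient in `Ω` is `G ∈ L²(Ω, ℝ³)`. -/
def IsDotH1WithGrad (Ω : Set E3) (φ : E3 → ℝ) (G : E3 → E3) : Prop :=
  LocallyIntegrableOn φ Ω ∧ MemLp G 2 (volume.restrict Ω) ∧ HasWeakGradOn Ω φ G

/-- The gauge-invariant local `L²` seminorm: the infimum of `‖F - ∇φ‖_{L²(Ω)}` over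
`φ ∈ Ḣ¹(Ω)`. It takes values in `[0, ∞]` and is finite for `F ∈ L²(Ω, ℝ³)`. -/
noncomputable def localGaugeSeminorm (Ω : Set E3) (F : E3 → E3) : ℝ≥0∞ :=
  ⨅ (φ : E3 → ℝ) (G : E3 → E3) (_ : IsDotH1WithGrad Ω φ G),
    eLpNorm (F - G) 2 (volume.restrict Ω)

/-
The difference `Dₙ = Aₙ - A` has curl `Cₙ ∈ L^{3/2}`, which is divergence free, so the Biot–Savart
field `bₙ = ∫ Cₙ(t) × K(· - t) dt`, with `K(z) = z / (4π|z|³)`, also has curl `Cₙ`. Hence `Dₙ - bₙ`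
is curl free, so by the Poincaré lemma for distributions it is the weak gradient of some `φₙ` on
all of `ℝ³`, and `|||Dₙ|||_{2Ω} ≤ ‖bₙ‖_{L²(Ω)}`.

It remains to see that `Cₙ ⇀ 0` forces `bₙ → 0` in `L²(Ω)` whenever `|Ω| < ∞`. Against a kernel in
`L³`, weak convergence gives pointwise convergence of a bounded sequence of convolutions, and
dominated convergence applies. The far part of `K` lies in `L³`, and the near part is approximated
in `L^{6/5}` by elements of `L³`, the error being controlled in `L²` by Young's inequality
`L^{3/2} ⋆ L^{6/5} ⊆ L²`.
-/

section Young

variable {G : Type*} [AddCommGroup G] [MeasurableSpace G] [MeasurableAdd₂ G] [MeasurableNeg G]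
  {μ : Measure G} [μ.IsAddLeftInvariant]

theorem rpow_inv_mul_rpow_sub_inv (c : ℝ≥0∞) {s r : ℝ} (hs : 0 < s) (hr : 0 < r)
    (hsr : r⁻¹ ≤ s⁻¹) : (c ^ s) ^ r⁻¹ * (c ^ s) ^ (s⁻¹ - r⁻¹) = c := by
  rw [← ENNReal.rpow_add_of_nonneg _ _ (by positivity) (by linarith), add_sub_cancel,
    ENNReal.rpow_rpow_inv hs.ne']

theorem lconvolution_le_of_inv_add_inv_eq [μ.IsNegInvariant] {p q r : ℝ} (hp : 0 < p) (hq : 0 < q)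
    (hr : 0 < r) (hpr : r⁻¹ ≤ p⁻¹) (hqr : r⁻¹ ≤ q⁻¹) (hpqr : p⁻¹ + q⁻¹ = 1 + r⁻¹)
    {f g : G → ℝ≥0∞} (hf : AEMeasurable f μ) (hg : AEMeasurable g μ) (x : G) :
    (f ⋆ₗ[μ] g) x ≤ ((fun y => f y ^ p) ⋆ₗ[μ] fun y => g y ^ q) x ^ r⁻¹ *
      (∫⁻ y, f y ^ p ∂μ) ^ (p⁻¹ - r⁻¹) * (∫⁻ y, g y ^ q ∂μ) ^ (q⁻¹ - r⁻¹) := by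
  have translate : ∫⁻ y, g (-y + x) ^ q ∂μ = ∫⁻ y, g y ^ q ∂μ := by
    rw [lintegral_neg_eq_self (fun y => g (y + x) ^ q),
      lintegral_add_right_eq_self (fun y => g y ^ q) x]
  have split (a b : ℝ≥0∞) :
      (a ^ p * b ^ q) ^ r⁻¹ * (a ^ p) ^ (p⁻¹ - r⁻¹) * (b ^ q) ^ (q⁻¹ - r⁻¹) = a * b := by
    rw [ENNReal.mul_rpow_of_nonneg _ _ (by positivity), mul_right_comm (_ ^ _), mul_assoc,
      rpow_inv_mul_rpow_sub_inv a hp hr hpr, rpow_inv_mul_rpow_sub_inv b hq hr hqr]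
  have hgx : AEMeasurable (fun y => g (-y + x)) μ :=
    hg.comp_quasiMeasurePreserving ((measurePreserving_add_right μ x).quasiMeasurePreserving.comp
      (Measure.measurePreserving_neg μ).quasiMeasurePreserving)
  have holder := ENNReal.lintegral_prod_norm_pow_le (μ := μ) Finset.univ
    (f := ![fun y => f y ^ p * g (-y + x) ^ q, fun y => f y ^ p, fun y => g (-y + x) ^ q])
    (p := ![r⁻¹, p⁻¹ - r⁻¹, q⁻¹ - r⁻¹])
    (by simpa [Fin.forall_fin_succ] using ⟨(hf.pow_const _).mul (hgx.pow_const _),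
        hf.pow_const _, hgx.pow_const _⟩)
    (by simp [Fin.sum_univ_three]; linarith)
    (by simpa [Fin.forall_fin_succ] using ⟨hr.le, hpr, hqr⟩)
  simpa [Fin.prod_univ_three, split, translate, lconvolution_def] using holder

variable [SFinite μ]

theorem lintegral_lconvolution {f g : G → ℝ≥0∞} (hf : AEMeasurable f μ) (hg : AEMeasurable g μ) :
    ∫⁻ x, (f ⋆ₗ[μ] g) x ∂μ = (∫⁻ x, f x ∂μ) * ∫⁻ x, g x ∂μ := by
  simp only [lconvolution_def]
  rw [lintegral_lintegral_swap (by fun_prop)]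
  have inner_eq (y : G) : ∫⁻ x, f y * g (-y + x) ∂μ = f y * ∫⁻ x, g x ∂μ := by
    rw [lintegral_const_mul'' _ (by fun_prop), lintegral_add_left_eq_self]
  simp only [inner_eq]
  exact lintegral_mul_const'' _ hf

theorem ne_top_of_inv_add_inv_eq {p q r : ℝ≥0∞} (hq : 1 ≤ q) (hr : r ≠ ⊤)
    (hpqr : p⁻¹ + q⁻¹ = 1 + r⁻¹) : p ≠ ⊤ := by
  rintro rfl
  have : 1 + r⁻¹ ≤ 1 + 0 := by
    rw [← hpqr, ENNReal.inv_top, zero_add, add_zero]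
    exact ENNReal.inv_le_one.2 hq
  simpa [hr] using (ENNReal.add_le_add_iff_left ENNReal.one_ne_top).1 this

theorem lintegral_lconvolution_rpow_le [μ.IsNegInvariant] {p q r : ℝ} (hp : 1 ≤ p) (hq : 1 ≤ q)
    (hr : 0 < r) (hpqr : p⁻¹ + q⁻¹ = 1 + r⁻¹) {f g : G → ℝ≥0∞} (hf : AEMeasurable f μ)
    (hg : AEMeasurable g μ) :
    (∫⁻ x, (f ⋆ₗ[μ] g) x ^ r ∂μ) ^ r⁻¹ ≤
      (∫⁻ x, f x ^ p ∂μ) ^ p⁻¹ * (∫⁻ x, g x ^ q ∂μ) ^ q⁻¹ := by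
  have hp₁ : p⁻¹ ≤ 1 := inv_le_one_of_one_le₀ hp
  have hq₁ : q⁻¹ ≤ 1 := inv_le_one_of_one_le₀ hq
  set a := ∫⁻ x, f x ^ p ∂μ
  set b := ∫⁻ x, g x ^ q ∂μ
  set F := (fun y => f y ^ p) ⋆ₗ[μ] fun y => g y ^ q
  set c := a ^ (p⁻¹ - r⁻¹) * b ^ (q⁻¹ - r⁻¹)
  calc (∫⁻ x, (f ⋆ₗ[μ] g) x ^ r ∂μ) ^ r⁻¹
      ≤ (∫⁻ x, (F x ^ r⁻¹ * c) ^ r ∂μ) ^ r⁻¹ := by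
        gcongr with x
        rw [← mul_assoc]
        exact lconvolution_le_of_inv_add_inv_eq (by positivity) (by positivity) hr
          (by linarith) (by linarith) hpqr hf hg x
    _ = ((∫⁻ x, F x ∂μ) * c ^ r) ^ r⁻¹ := by
        simp only [ENNReal.mul_rpow_of_nonneg _ _ hr.le, ENNReal.rpow_inv_rpow hr.ne']
        rw [lintegral_mul_const'' _ (by fun_prop)]
    _ = (a * b) ^ r⁻¹ * c := by
        rw [lintegral_lconvolution (hf.pow_const _) (hg.pow_const _),
          ENNReal.mul_rpow_of_nonneg _ _ (by positivity), ENNReal.rpow_rpow_inv hr.ne']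
    _ = a ^ p⁻¹ * b ^ q⁻¹ := by
        rw [ENNReal.mul_rpow_of_nonneg _ _ (by positivity), mul_mul_mul_comm,
          ← ENNReal.rpow_add_of_nonneg _ _ (by positivity) (by linarith),
          ← ENNReal.rpow_add_of_nonneg _ _ (by positivity) (by linarith), add_sub_cancel,
          add_sub_cancel]

theorem ne_zero_of_inv_add_inv_eq {p q r : ℝ≥0∞} (hp : 1 ≤ p) (hq : 1 ≤ q)
    (hpqr : p⁻¹ + q⁻¹ = 1 + r⁻¹) : r ≠ 0 := by
  rintro rfl
  simpa [hpqr] using (add_le_add (ENNReal.inv_le_one.2 hp) (ENNReal.inv_le_one.2 hq)).trans_lt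
    (by finiteness)

theorem eLpNorm_lconvolution_le [μ.IsNegInvariant] {p q r : ℝ≥0∞} (hp : 1 ≤ p) (hq : 1 ≤ q)
    (hr : r ≠ ⊤) (hpqr : p⁻¹ + q⁻¹ = 1 + r⁻¹) {f g : G → ℝ≥0∞} (hf : AEMeasurable f μ)
    (hg : AEMeasurable g μ) :
    eLpNorm (f ⋆ₗ[μ] g) r μ ≤ eLpNorm f p μ * eLpNorm g q μ := by
  have hr₀ : r ≠ 0 := ne_zero_of_inv_add_inv_eq hp hq hpqr
  lift p to NNReal using ne_top_of_inv_add_inv_eq hq hr hpqr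
  lift q to NNReal using ne_top_of_inv_add_inv_eq hp hr (by rwa [add_comm])
  lift r to NNReal using hr
  norm_cast at hp hq hr₀
  have hp₀ : p ≠ 0 := (one_pos.trans_le hp).ne'
  have hq₀ : q ≠ 0 := (one_pos.trans_le hq).ne'
  have hpqr : (p : ℝ)⁻¹ + (q : ℝ)⁻¹ = 1 + (r : ℝ)⁻¹ := by
    rw [← ENNReal.coe_inv hp₀, ← ENNReal.coe_inv hq₀, ← ENNReal.coe_inv hr₀] at hpqr
    exact_mod_cast hpqr
  rw [eLpNorm_nnreal_eq_lintegral hp₀, eLpNorm_nnreal_eq_lintegral hq₀,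
    eLpNorm_nnreal_eq_lintegral hr₀]
  simp only [enorm_eq_self, one_div]
  exact lintegral_lconvolution_rpow_le hp hq (NNReal.coe_pos.2 (pos_of_ne_zero hr₀)) hpqr hf
    hg

end Young

section Convolution

open scoped Convolution

variable {G : Type*} [AddCommGroup G] [MeasurableSpace G] {μ : Measure G}
  {E E' F : Type*} [NormedAddCommGroup E] [NormedSpace ℝ E] [NormedAddCommGroup E']
  [NormedSpace ℝ E'] [NormedAddCommGroup F] [NormedSpace ℝ F] (L : E →L[ℝ] E' →L[ℝ] F)
  {f : G → E} {g : G → E'} {p q r : ℝ≥0∞}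

theorem lintegral_enorm_convolution_integrand_le (x : G) :
    ∫⁻ t, ‖L (f t) (g (x - t))‖ₑ ∂μ ≤ ‖L‖ₑ * ((‖f ·‖ₑ) ⋆ₗ[μ] (‖g ·‖ₑ)) x := by
  rw [lconvolution_def, ← lintegral_const_mul' _ _ enorm_ne_top]
  refine lintegral_mono fun t => ?_
  rw [neg_add_eq_sub, ← mul_assoc]
  exact L.le_opENorm₂ _ _

theorem enorm_convolution_le (x : G) :
    ‖(f ⋆[L, μ] g) x‖ₑ ≤ ‖L‖ₑ * ((‖f ·‖ₑ) ⋆ₗ[μ] (‖g ·‖ₑ)) x :=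
  (enorm_integral_le_lintegral_enorm _).trans (lintegral_enorm_convolution_integrand_le L x)

variable [MeasurableAdd₂ G] [MeasurableNeg G] [μ.IsAddLeftInvariant]

theorem aestronglyMeasurable_convolution [SFinite μ] (hf : AEStronglyMeasurable f μ)
    (hg : AEStronglyMeasurable g μ) : AEStronglyMeasurable (f ⋆[L, μ] g) μ :=
  (hf.convolution_integrand L hg).integral_prod_right'

variable [μ.IsNegInvariant]

theorem convolutionExists_of_holderConjugate [p.HolderConjugate q] (hf : MemLp f p μ)
    (hg : MemLp g q μ) : ConvolutionExists f g L μ := fun x =>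
  memLp_one_iff_integrable.1 <|
    L.memLp_of_bilin 1 hf (hg.comp_measurePreserving (Measure.measurePreserving_sub_left μ x))

theorem convolution_eq_lpPairing [p.HolderConjugate q] [Fact (1 ≤ p)] [Fact (1 ≤ q)]
    [CompleteSpace F] (u : Lp E p μ) (hg : MemLp g q μ) (x : G) :
    (u ⋆[L, μ] g) x = L.lpPairing μ p q u
      ((hg.comp_measurePreserving (Measure.measurePreserving_sub_left μ x)).toLp) := by
  rw [ContinuousLinearMap.lpPairing_eq_integral]
  refine integral_congr_ae ?_
  filter_upwards [MemLp.coeFn_toLp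
    (hg.comp_measurePreserving (Measure.measurePreserving_sub_left μ x))] with t ht
  rw [ht]
  rfl

theorem enorm_convolution_le_of_holderConjugate [p.HolderConjugate q] [Fact (1 ≤ p)]
    [Fact (1 ≤ q)] [CompleteSpace F] (u : Lp E p μ) (hg : MemLp g q μ) (x : G) :
    ‖(u ⋆[L, μ] g) x‖ₑ ≤ ‖L.lpPairing μ p q‖ₑ * ‖u‖ₑ * eLpNorm g q μ := by
  rw [convolution_eq_lpPairing L u hg, ← eLpNorm_comp_measurePreserving hg.1
    (Measure.measurePreserving_sub_left μ x), ← Lp.enorm_toLp]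
  exact ContinuousLinearMap.le_opENorm₂ _ _ _

variable [SFinite μ]

theorem eLpNorm_convolution_le (hp : 1 ≤ p) (hq : 1 ≤ q) (hr : r ≠ ⊤)
    (hpqr : p⁻¹ + q⁻¹ = 1 + r⁻¹) (hf : AEStronglyMeasurable f μ) (hg : AEStronglyMeasurable g μ) :
    eLpNorm (f ⋆[L, μ] g) r μ ≤ ‖L‖ₑ * (eLpNorm f p μ * eLpNorm g q μ) := by
  calc eLpNorm (f ⋆[L, μ] g) r μ
      ≤ ‖L‖ₑ * eLpNorm ((‖f ·‖ₑ) ⋆ₗ[μ] (‖g ·‖ₑ)) r μ :=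
        eLpNorm_le_mul_eLpNorm_of_ae_le_mul' (c := ‖L‖₊)
          (.of_forall fun x => enorm_convolution_le L x) r
    _ ≤ ‖L‖ₑ * (eLpNorm f p μ * eLpNorm g q μ) := by
        gcongr
        simpa only [eLpNorm_enorm] using eLpNorm_lconvolution_le hp hq hr hpqr hf.enorm hg.enorm

theorem ae_convolutionExistsAt (hp : 1 ≤ p) (hq : 1 ≤ q) (hr : r ≠ ⊤)
    (hpqr : p⁻¹ + q⁻¹ = 1 + r⁻¹) (hf : MemLp f p μ) (hg : MemLp g q μ) :
    ∀ᵐ x ∂μ, ConvolutionExistsAt f g x L μ := by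
  have hr₀ : r ≠ 0 := ne_zero_of_inv_add_inv_eq hp hq hpqr
  have finite : ∫⁻ x, ‖((‖f ·‖ₑ) ⋆ₗ[μ] (‖g ·‖ₑ)) x‖ₑ ^ r.toReal ∂μ < ⊤ := by
    refine lintegral_rpow_enorm_lt_top_of_eLpNorm_lt_top hr₀ hr
      ((eLpNorm_lconvolution_le hp hq hr hpqr hf.1.enorm hg.1.enorm).trans_lt ?_)
    simpa only [eLpNorm_enorm] using ENNReal.mul_lt_top hf.2 hg.2
  filter_upwards [ae_lt_top' ((aemeasurable_lconvolution hf.1.enorm hg.1.enorm).enorm.pow_const _)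
    finite.ne] with x hx
  refine ⟨hf.1.convolution_integrand_snd L hg.1 x, ?_⟩
  refine (lintegral_enorm_convolution_integrand_le L x).trans_lt
    (ENNReal.mul_lt_top enorm_lt_top ?_)
  simpa only [enorm_eq_self, ENNReal.rpow_lt_top_iff_of_pos (ENNReal.toReal_pos hr₀ hr)] using hx

theorem memLp_convolution (hp : 1 ≤ p) (hq : 1 ≤ q) (hr : r ≠ ⊤)
    (hpqr : p⁻¹ + q⁻¹ = 1 + r⁻¹) (hf : MemLp f p μ) (hg : MemLp g q μ) :
    MemLp (f ⋆[L, μ] g) r μ :=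
  ⟨aestronglyMeasurable_convolution L hf.1 hg.1,
    (eLpNorm_convolution_le L hp hq hr hpqr hf.1 hg.1).trans_lt
      (ENNReal.mul_lt_top enorm_lt_top (ENNReal.mul_lt_top hf.2 hg.2))⟩

theorem convolution_add_ae_eq {p' : ℝ≥0∞} {g' : G → E'} [p.HolderConjugate p'] (hp : 1 ≤ p)
    (hq : 1 ≤ q) (hr : r ≠ ⊤) (hpqr : p⁻¹ + q⁻¹ = 1 + r⁻¹) (hf : MemLp f p μ) (hg : MemLp g q μ)
    (hg' : MemLp g' p' μ) : f ⋆[L, μ] (g + g') =ᵐ[μ] (f ⋆[L, μ] g) + (f ⋆[L, μ] g') := by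
  filter_upwards [ae_convolutionExistsAt L hp hq hr hpqr hf hg] with x hx
  exact hx.distrib_add (convolutionExists_of_holderConjugate L hf hg' x)

end Convolution

section WeakConvergence

theorem tendsto_apply_of_tendsto_toWeakSpace {ι V F : Type*} [NormedAddCommGroup V]
    [NormedSpace ℝ V] [NormedAddCommGroup F] [NormedSpace ℝ F] [FiniteDimensional ℝ F]
    {l : Filter ι} {u : ι → V} {u₀ : V}
    (hu : Tendsto (fun i => toWeakSpace ℝ V (u i)) l (𝓝 (toWeakSpace ℝ V u₀))) (T : V →L[ℝ] F) :
    Tendsto (fun i => T (u i)) l (𝓝 (T u₀)) := by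
  have weak := ((WeakSpace.map T).continuous.tendsto _).comp hu
  have : FiniteDimensional ℝ (WeakSpace ℝ F) := Module.Finite.equiv (toWeakSpace ℝ F)
  have strong := (LinearMap.continuous_of_finiteDimensional
    (toWeakSpace ℝ F).symm.toLinearMap).tendsto (toWeakSpace ℝ F (T u₀))
  exact strong.comp weak

theorem exists_norm_le_of_tendsto_toWeakSpace {V : Type*} [NormedAddCommGroup V]
    [NormedSpace ℝ V] {u : ℕ → V} {u₀ : V}
    (hu : Tendsto (fun n => toWeakSpace ℝ V (u n)) atTop (𝓝 (toWeakSpace ℝ V u₀))) :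
    ∃ C, ∀ n, ‖u n‖ ≤ C := by
  have pointwise_bounded (ℓ : StrongDual ℝ V) :
      ∃ C, ∀ n, ‖NormedSpace.inclusionInDoubleDual ℝ V (u n) ℓ‖ ≤ C := by
    obtain ⟨C, hC⟩ := (tendsto_apply_of_tendsto_toWeakSpace hu ℓ).norm.bddAbove_range
    exact ⟨C, fun n => hC ⟨n, rfl⟩⟩
  obtain ⟨C, hC⟩ := banach_steinhaus pointwise_bounded
  exact ⟨C, fun n => by
    simpa using (NormedSpace.inclusionInDoubleDualLi ℝ (E := V)).norm_map (u n) ▸ hC n⟩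

end WeakConvergence

section Compactness

open scoped Convolution

theorem tendsto_eLpNorm_zero_of_forall_enorm_le {α F : Type*} [MeasurableSpace α]
    [NormedAddCommGroup F] {ν : Measure α} [IsFiniteMeasure ν] {r : ℝ≥0∞} (hr : r ≠ ⊤)
    {f : ℕ → α → F} (hf : ∀ n, AEStronglyMeasurable (f n) ν) {C : ℝ≥0∞} (hC : C ≠ ⊤)
    (hfC : ∀ n x, ‖f n x‖ₑ ≤ C) (hlim : ∀ x, Tendsto (f · x) atTop (𝓝 0)) :
    Tendsto (fun n => eLpNorm (f n) r ν) atTop (𝓝 0) := by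
  rcases eq_or_ne r 0 with rfl | hr₀
  · simp
  have hr_pos : 0 < r.toReal := ENNReal.toReal_pos hr₀ hr
  have lim : Tendsto (fun n => ∫⁻ x, ‖f n x‖ₑ ^ r.toReal ∂ν) atTop (𝓝 (∫⁻ _, 0 ∂ν)) := by
    refine tendsto_lintegral_of_dominated_convergence' (fun _ => C ^ r.toReal)
      (fun n => (hf n).enorm.pow_const _) (fun n => .of_forall fun x => ?_) ?_
      (.of_forall fun x => ?_)
    · exact ENNReal.rpow_le_rpow (hfC n x) hr_pos.le
    · simp [ENNReal.mul_eq_top, hC, hr_pos.le]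
    · simpa [hr_pos] using (hlim x).enorm.ennrpow_const r.toReal
  simp only [eLpNorm_eq_lintegral_rpow_enorm_toReal hr₀ hr]
  simpa [hr_pos] using lim.ennrpow_const (1 / r.toReal)

variable {G : Type*} [AddCommGroup G] [MeasurableSpace G] [MeasurableAdd₂ G] [MeasurableNeg G]
  {μ : Measure G} [SFinite μ] [μ.IsAddLeftInvariant] [μ.IsNegInvariant]
  {E E' F : Type*} [NormedAddCommGroup E] [NormedSpace ℝ E] [NormedAddCommGroup E']
  [NormedSpace ℝ E'] [NormedAddCommGroup F] [NormedSpace ℝ F] [FiniteDimensional ℝ F]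
  (L : E →L[ℝ] E' →L[ℝ] F) {p q r s : ℝ≥0∞} [Fact (1 ≤ p)] [Fact (1 ≤ q)] [p.HolderConjugate q]
  {u : ℕ → Lp E p μ} {K K' : G → E'} {S : Set G}

theorem tendsto_eLpNorm_convolution_of_holderConjugate
    (hu : Tendsto (fun n => toWeakSpace ℝ (Lp E p μ) (u n)) atTop (𝓝 (toWeakSpace ℝ _ 0)))
    (hK : MemLp K q μ) (hr : r ≠ ⊤) (hS : μ S ≠ ⊤) :
    Tendsto (fun n => eLpNorm (u n ⋆[L, μ] K) r (μ.restrict S)) atTop (𝓝 0) := by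
  have : CompleteSpace F := FiniteDimensional.complete ℝ F
  have : IsFiniteMeasure (μ.restrict S) := isFiniteMeasure_restrict.2 hS
  obtain ⟨C, hC⟩ := exists_norm_le_of_tendsto_toWeakSpace hu
  have bound (n : ℕ) (x : G) : ‖(u n ⋆[L, μ] K) x‖ₑ ≤
      ‖L.lpPairing μ p q‖ₑ * ENNReal.ofReal C * eLpNorm K q μ := by
    refine (enorm_convolution_le_of_holderConjugate L (u n) hK x).trans ?_
    gcongr
    rw [← ofReal_norm]
    exact ENNReal.ofReal_le_ofReal (hC n)
  refine tendsto_eLpNorm_zero_of_forall_enorm_le hr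
    (fun n => (aestronglyMeasurable_convolution L (Lp.aestronglyMeasurable _) hK.1).restrict)
    ?_ bound fun x => ?_
  · have := hK.2.ne
    finiteness
  · simp only [convolution_eq_lpPairing L _ hK]
    simpa using tendsto_apply_of_tendsto_toWeakSpace hu ((L.lpPairing μ p q).flip _)

theorem exists_memLp_memLp_eLpNorm_sub_lt {α F : Type*} [MeasurableSpace α] [NormedAddCommGroup F]
    {ν : Measure α} {s : ℝ≥0∞} (hs₀ : s ≠ 0) (hs : s ≠ ⊤) (q : ℝ≥0∞) {f : α → F} (hf : MemLp f s ν)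
    {ε : ℝ≥0∞} (hε : ε ≠ 0) :
    ∃ g : α → F, MemLp g s ν ∧ MemLp g q ν ∧ eLpNorm (f - g) s ν < ε := by
  obtain ⟨σ, hσ, hσs⟩ := hf.exists_simpleFunc_eLpNorm_sub_lt hs hε
  exact ⟨σ, hσs, σ.memLp_of_finite_measure_preimage q
    (σ.measure_preimage_lt_top_of_memLp hs₀ hs hσs), hσ⟩

theorem tendsto_eLpNorm_convolution_add (hs : s ≠ ⊤) (hs₁ : 1 ≤ s) (hr₁ : 1 ≤ r) (hr : r ≠ ⊤)
    (hpsr : p⁻¹ + s⁻¹ = 1 + r⁻¹)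
    (hu : Tendsto (fun n => toWeakSpace ℝ (Lp E p μ) (u n)) atTop (𝓝 (toWeakSpace ℝ _ 0)))
    (hK : MemLp K s μ) (hK' : MemLp K' q μ) (hS : μ S ≠ ⊤) :
    Tendsto (fun n => eLpNorm (u n ⋆[L, μ] (K + K')) r (μ.restrict S)) atTop (𝓝 0) := by
  obtain ⟨C, hC⟩ := exists_norm_le_of_tendsto_toWeakSpace hu
  refine ENNReal.tendsto_nhds_zero.2 fun ε hε => ?_
  obtain ⟨δ, hδ, hδε⟩ := ENNReal.exists_nnreal_pos_mul_lt (a := ‖L‖ₑ * ENNReal.ofReal C)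
    (by finiteness) (ENNReal.half_pos hε.ne').ne'
  -- A simple function is in `L^q` too, so only a part of the kernel small in `Lˢ` is left.
  obtain ⟨k, hks, hkq, hk⟩ :=
    exists_memLp_memLp_eLpNorm_sub_lt (one_pos.trans_le hs₁).ne' hs q hK
      (ENNReal.coe_ne_zero.2 hδ.ne')
  have small (n : ℕ) : eLpNorm (u n ⋆[L, μ] (K - k)) r μ ≤ ε / 2 := by
    refine (eLpNorm_convolution_le L Fact.out hs₁ hr hpsr (Lp.aestronglyMeasurable _)
      (hK.1.sub hks.1)).trans (le_trans ?_ hδε.le)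
    rw [mul_comm (δ : ℝ≥0∞), mul_assoc]
    gcongr
    rw [← Lp.enorm_def, ← ofReal_norm]
    exact ENNReal.ofReal_le_ofReal (hC n)
  have split (n : ℕ) :
      u n ⋆[L, μ] (K + K') =ᵐ[μ] (u n ⋆[L, μ] (K - k)) + (u n ⋆[L, μ] (k + K')) := by
    rw [← sub_add_add_cancel K K' k, add_comm K' k]
    exact convolution_add_ae_eq L Fact.out hs₁ hr hpsr (Lp.memLp _) (hK.sub hks) (hkq.add hK')
  have meas (n : ℕ) {H : G → E'} (hH : AEStronglyMeasurable H μ) :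
      AEStronglyMeasurable (u n ⋆[L, μ] H) (μ.restrict S) :=
    (aestronglyMeasurable_convolution L (Lp.aestronglyMeasurable _) hH).restrict
  filter_upwards [(tendsto_eLpNorm_convolution_of_holderConjugate L hu (hkq.add hK') hr
    hS).eventually_le_const (ENNReal.half_pos hε.ne')] with n hn
  calc eLpNorm (u n ⋆[L, μ] (K + K')) r (μ.restrict S)
      ≤ eLpNorm (u n ⋆[L, μ] (K - k)) r (μ.restrict S) +
          eLpNorm (u n ⋆[L, μ] (k + K')) r (μ.restrict S) := by
        rw [eLpNorm_congr_ae (ae_restrict_of_ae (split n))]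
        exact eLpNorm_add_le (meas n (hK.1.sub hks.1)) (meas n (hkq.1.add hK'.1)) hr₁
    _ ≤ ε / 2 + ε / 2 :=
        add_le_add ((eLpNorm_mono_measure _ Measure.restrict_le_self).trans (small n)) hn
    _ = ε := ENNReal.add_halves ε

end Compactness

section Duality

open scoped Convolution

variable {G : Type*} [AddCommGroup G] [MeasurableSpace G] [MeasurableAdd₂ G] [MeasurableNeg G]
  {μ : Measure G} [SFinite μ] [μ.IsAddLeftInvariant] [μ.IsNegInvariant]

-- Integrating in `x` first leaves the pairing of `f ∈ Lˢ` with `‖h‖ ⋆ ‖g (-·)‖ ∈ Lʳ`.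
theorem integrable_prod_convolution_integrand {E E' H : Type*} [NormedAddCommGroup E]
    [NormedAddCommGroup E'] [NormedAddCommGroup H] {f : G → E} {g : G → E'} {h : G → H}
    {p q r s : ℝ≥0∞} [s.HolderConjugate r] (hp : 1 ≤ p) (hq : 1 ≤ q) (hr : r ≠ ⊤)
    (hpqr : p⁻¹ + q⁻¹ = 1 + r⁻¹) (hf : MemLp f s μ) (hg : MemLp g q μ) (hh : MemLp h p μ) :
    Integrable (fun z : G × G => ‖f z.2‖ * (‖h z.1‖ * ‖g (z.1 - z.2)‖)) (μ.prod μ) := by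
  have hg_neg : MemLp (fun x => ‖g (-x)‖) q μ :=
    (hg.comp_measurePreserving (Measure.measurePreserving_neg μ)).norm
  have conv : MemLp ((‖h ·‖) ⋆[ContinuousLinearMap.mul ℝ ℝ, μ] fun x => ‖g (-x)‖) r μ :=
    memLp_convolution _ hp hq hr hpqr hh.norm hg_neg
  refine (integrable_prod_iff' ?_).2 ⟨?_, ?_⟩
  · exact hf.1.norm.comp_snd.mul (hh.1.norm.comp_fst.mul
      (hg.1.norm.comp_quasiMeasurePreserving (quasiMeasurePreserving_sub μ μ)))
  · filter_upwards [ae_convolutionExistsAt (ContinuousLinearMap.mul ℝ ℝ) hp hq hr hpqr hh.norm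
      hg_neg] with y hy
    simpa [ConvolutionExistsAt] using hy.const_mul ‖f y‖
  · refine (hf.norm.integrable_mul conv).congr (.of_forall fun y => ?_)
    simp [convolution_def, integral_const_mul]

end Duality

section RadialPowers

open Module

variable {E : Type*} [NormedAddCommGroup E] [NormedSpace ℝ E] [FiniteDimensional ℝ E]
  [Nontrivial E]

theorem pow_finrank_sub_one_mul_rpow (a : ℝ) {y : ℝ} (hy : 0 < y) :
    y ^ (finrank ℝ E - 1) * y ^ a = y ^ (a + finrank ℝ E - 1) := by
  rw [← Real.rpow_natCast, ← Real.rpow_add hy, Nat.cast_pred finrank_pos]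
  ring_nf

variable [MeasurableSpace E] [BorelSpace E] (μ : Measure E) [μ.IsAddHaarMeasure]

theorem integrableOn_ball_norm_rpow {a : ℝ} (ha : 0 < a + finrank ℝ E) {R : ℝ} (hR : 0 < R) :
    IntegrableOn (fun z : E => ‖z‖ ^ a) (Metric.ball 0 R) μ := by
  refine (integrableOn_fun_norm_addHaar μ (f := fun y : ℝ => y ^ a)).2 ?_
  refine ((intervalIntegral.integrableOn_Ioo_rpow_iff (s := a + finrank ℝ E - 1) hR).2
    (by linarith)).congr_fun (fun y hy => ?_) measurableSet_Ioo
  exact (pow_finrank_sub_one_mul_rpow a hy.1).symm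

theorem integrableOn_compl_ball_norm_rpow {a : ℝ} (ha : a + finrank ℝ E < 0) {R : ℝ}
    (hR : 0 < R) : IntegrableOn (fun z : E => ‖z‖ ^ a) (Metric.ball 0 R)ᶜ μ := by
  rw [← integrable_indicator_iff measurableSet_ball.compl]
  have as_radial : (Metric.ball 0 R)ᶜ.indicator (fun z : E => ‖z‖ ^ a) =
      fun z => (Set.Ici R).indicator (fun y : ℝ => y ^ a) ‖z‖ := by
    ext z
    by_cases h : R ≤ ‖z‖ <;> simp [Set.indicator, h]
  rw [as_radial, integrable_fun_norm_addHaar μ]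
  have tail := (integrable_indicator_iff measurableSet_Ici).2 <|
    (integrableOn_Ici_iff_integrableOn_Ioi (μ := volume)).2 <|
    integrableOn_Ioi_rpow_of_lt (a := a + finrank ℝ E - 1) (by linarith) hR
  refine tail.integrableOn.congr_fun (fun y hy => ?_) measurableSet_Ioi
  by_cases h : R ≤ y
  · simp only [Set.indicator, Set.mem_Ici, h, if_true, smul_eq_mul]
    exact (pow_finrank_sub_one_mul_rpow a hy).symm
  · simp [h]

end RadialPowers

section PointSource

open Module

theorem integral_Ioi_fderiv_sub_smul {E F : Type*} [NormedAddCommGroup E] [NormedSpace ℝ E]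
    [NormedAddCommGroup F] [NormedSpace ℝ F] [CompleteSpace F] {g : E → F} (hg : ContDiff ℝ 1 g)
    (hg_supp : HasCompactSupport g) (x : E) {v : E} (hv : v ≠ 0) :
    ∫ r in Set.Ioi (0 : ℝ), fderiv ℝ g (x - r • v) v = g x := by
  have hd (r : ℝ) : HasDerivAt (fun r : ℝ => g (x - r • v)) (-fderiv ℝ g (x - r • v) v) r := by
    have line : HasDerivAt (fun r : ℝ => x - r • v) (-v) r := by
      simpa using ((hasDerivAt_id r).smul_const v).const_sub x
    simpa using! ((hg.differentiable one_ne_zero) (x - r • v)).hasFDerivAt.comp_hasDerivAt r line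
  have smooth : ContDiff ℝ 1 fun r : ℝ => g (x - r • v) := by fun_prop
  have supp : HasCompactSupport fun r : ℝ => g (x - r • v) :=
    hg_supp.comp_isClosedEmbedding ((Homeomorph.subLeft x).isClosedEmbedding.comp
      (isClosedEmbedding_smul_left hv))
  have ftc := supp.integral_Ioi_deriv_eq smooth 0
  simp_rw [fun r => (hd r).deriv, integral_neg] at ftc
  simpa using ftc

variable {E : Type*} [NormedAddCommGroup E] [NormedSpace ℝ E] [MeasurableSpace E]

/-- The field of a unit point source at the origin: the radial field `z / (ω ‖z‖ᵈ)` in dimension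
`d`, where `ω` is the area of the unit sphere. It has divergence `δ₀`, and it is the gradient of
the fundamental solution of the Laplacian if the norm is Euclidean. -/
noncomputable def pointSourceField (μ : Measure E) (z : E) : E :=
  (μ.toSphere.real Set.univ * ‖z‖ ^ finrank ℝ E)⁻¹ • z

theorem pointSourceField_neg (μ : Measure E) (z : E) :
    pointSourceField μ (-z) = -pointSourceField μ z := by
  simp [pointSourceField]

variable (μ : Measure E)

theorem norm_pointSourceField_le (z : E) :
    ‖pointSourceField μ z‖ ≤ (μ.toSphere.real Set.univ)⁻¹ * ‖z‖ ^ (1 - finrank ℝ E : ℝ) := by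
  rcases eq_or_ne z 0 with rfl | hz
  · simp only [pointSourceField, smul_zero, norm_zero]
    positivity
  have hz' : 0 < ‖z‖ := norm_pos_iff.2 hz
  rw [pointSourceField, norm_smul, norm_inv, norm_mul, norm_pow, norm_norm,
    Real.norm_of_nonneg (by positivity), Real.rpow_sub hz', Real.rpow_one, Real.rpow_natCast,
    mul_inv, mul_assoc, mul_comm _ ‖z‖, div_eq_mul_inv]

variable [FiniteDimensional ℝ E] [BorelSpace E]

theorem measurable_pointSourceField : Measurable (pointSourceField μ) :=
  ((measurable_norm.pow_const _).const_mul _).inv.smul measurable_id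

theorem memLp_pointSourceField_restrict {s : ℝ≥0∞} (hs₀ : s ≠ 0) (hs : s ≠ ⊤) {S : Set E}
    (hS : IntegrableOn (fun z => ‖z‖ ^ ((1 - finrank ℝ E) * s.toReal)) S μ) :
    MemLp (pointSourceField μ) s (μ.restrict S) := by
  have power : MemLp (fun z : E => ‖z‖ ^ (1 - finrank ℝ E : ℝ)) s (μ.restrict S) := by
    rw [← integrable_norm_rpow_iff (measurable_norm.pow_const _).aestronglyMeasurable hs₀ hs]
    refine hS.congr (.of_forall fun z => ?_)
    simp only
    rw [Real.norm_of_nonneg (by positivity), Real.rpow_mul (norm_nonneg z)]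
  refine (power.const_mul _).mono (measurable_pointSourceField μ).aestronglyMeasurable
    (.of_forall fun z => (norm_pointSourceField_le μ z).trans (le_abs_self _))

variable [Nontrivial E] [μ.IsAddHaarMeasure]

theorem memLp_pointSourceField_ball {s : ℝ≥0∞} (hs₀ : s ≠ 0) (hs : s ≠ ⊤)
    (h : (finrank ℝ E - 1) * s.toReal < finrank ℝ E) {R : ℝ} (hR : 0 < R) :
    MemLp (pointSourceField μ) s (μ.restrict (Metric.ball 0 R)) :=
  memLp_pointSourceField_restrict μ hs₀ hs (integrableOn_ball_norm_rpow μ (by linarith) hR)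

theorem memLp_pointSourceField_compl_ball {s : ℝ≥0∞} (hs₀ : s ≠ 0) (hs : s ≠ ⊤)
    (h : finrank ℝ E < (finrank ℝ E - 1) * s.toReal) {R : ℝ} (hR : 0 < R) :
    MemLp (pointSourceField μ) s (μ.restrict (Metric.ball 0 R)ᶜ) :=
  memLp_pointSourceField_restrict μ hs₀ hs (integrableOn_compl_ball_norm_rpow μ (by linarith) hR)

theorem locallyIntegrable_pointSourceField : LocallyIntegrable (pointSourceField μ) μ := by
  intro x
  refine ⟨Metric.ball 0 (‖x‖ + 1), Metric.isOpen_ball.mem_nhds (by simp), ?_⟩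
  exact memLp_one_iff_integrable.1 <|
    memLp_pointSourceField_ball μ one_ne_zero ENNReal.one_ne_top (by simp) (by positivity)

theorem integral_eq_integral_toSphere_integral_Ioi {F : Type*} [NormedAddCommGroup F]
    [NormedSpace ℝ F] {f : E → F} (hf : Integrable f μ) :
    ∫ x, f x ∂μ = ∫ u : Metric.sphere (0 : E) 1,
      (∫ r in Set.Ioi (0 : ℝ), r ^ (finrank ℝ E - 1) • f (r • (u : E))) ∂μ.toSphere := by
  have polar := μ.measurePreserving_homeomorphUnitSphereProd
  have emb := (homeomorphUnitSphereProd E).measurableEmbedding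
  set g : Metric.sphere (0 : E) 1 × Set.Ioi (0 : ℝ) → F :=
    fun p => f ((p.2 : ℝ) • (p.1 : E)) with hg
  have g_polar (x : ({0}ᶜ : Set E)) : g (homeomorphUnitSphereProd E x) = f x := by
    simp only [hg, homeomorphUnitSphereProd_apply_fst_coe, homeomorphUnitSphereProd_apply_snd_coe]
    rw [smul_inv_smul₀ (norm_ne_zero_iff.2 x.2)]
  have integrable_g : Integrable g (μ.toSphere.prod (.volumeIoiPow (finrank ℝ E - 1))) := by
    refine (polar.integrable_comp_emb emb).1 ?_
    rw [show g ∘ homeomorphUnitSphereProd E = f ∘ Subtype.val from funext g_polar,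
      ← integrableOn_iff_comap_subtypeVal (measurableSet_singleton _).compl]
    exact hf.integrableOn
  calc ∫ x, f x ∂μ = ∫ x : ({0}ᶜ : Set E), f x ∂(Measure.comap Subtype.val μ) := by
        rw [integral_subtype_comap (measurableSet_singleton _).compl f, restrict_compl_singleton]
    _ = ∫ p, g p ∂μ.toSphere.prod (.volumeIoiPow (finrank ℝ E - 1)) := by
        simp only [← polar.integral_comp emb g, g_polar]
    _ = ∫ u, ∫ r, g (u, r) ∂(.volumeIoiPow (finrank ℝ E - 1)) ∂μ.toSphere :=
        integral_prod _ integrable_g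
    _ = _ := by
      congr 1 with u
      simp only [Measure.volumeIoiPow, ENNReal.ofReal]
      rw [integral_withDensity_eq_integral_smul
          ((measurable_subtype_coe.pow_const _).real_toNNReal),
        integral_subtype_comap measurableSet_Ioi
          fun a : ℝ => Real.toNNReal (a ^ (finrank ℝ E - 1)) • f (a • (u : E))]
      refine setIntegral_congr_fun measurableSet_Ioi fun r (hr : 0 < r) => ?_
      simp only [NNReal.smul_def]
      rw [Real.coe_toNNReal _ (by positivity)]

theorem integrable_fderiv_pointSourceField {F : Type*} [NormedAddCommGroup F] [NormedSpace ℝ F]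
    {g : E → F} (hg : ContDiff ℝ 1 g) (hg_supp : HasCompactSupport g) (x : E) :
    Integrable (fun t => fderiv ℝ g (x - t) (pointSourceField μ t)) μ :=
  (hg_supp.fderiv ℝ).convolutionExists_right (ContinuousLinearMap.id ℝ (E →L[ℝ] F)).flip
    (locallyIntegrable_pointSourceField μ) (hg.continuous_fderiv one_ne_zero) x

theorem integral_fderiv_pointSourceField {F : Type*} [NormedAddCommGroup F] [NormedSpace ℝ F]
    [CompleteSpace F] {g : E → F} (hg : ContDiff ℝ 1 g) (hg_supp : HasCompactSupport g) (x : E) :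
    ∫ t, fderiv ℝ g (x - t) (pointSourceField μ t) ∂μ = g x := by
  set area := μ.toSphere.real Set.univ with area_def
  have area_ne_zero : area ≠ 0 := by
    rw [area_def, measureReal_def, ENNReal.toReal_ne_zero]
    exact ⟨by simp [Measure.toSphere_apply_univ, finrank_pos.ne',
      (Metric.measure_ball_pos μ (0 : E) one_pos).ne'], measure_ne_top _ _⟩
  have ray (u : Metric.sphere (0 : E) 1) : ∫ r in Set.Ioi (0 : ℝ), r ^ (finrank ℝ E - 1) •
      fderiv ℝ g (x - r • (u : E)) (pointSourceField μ (r • (u : E))) = area⁻¹ • g x := by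
    rw [← integral_Ioi_fderiv_sub_smul hg hg_supp x (Metric.ne_of_mem_sphere u.2 one_ne_zero),
      ← integral_smul]
    refine setIntegral_congr_fun measurableSet_Ioi fun r (hr : 0 < r) => ?_
    have : r ^ finrank ℝ E = r ^ (finrank ℝ E - 1) * r := (pow_sub_one_mul finrank_pos.ne' r).symm
    simp only [pointSourceField, ← area_def, norm_smul, norm_eq_of_mem_sphere, mul_one,
      Real.norm_of_nonneg hr.le, map_smul, smul_smul, this]
    field_simp
  rw [integral_eq_integral_toSphere_integral_Ioi μ
    (integrable_fderiv_pointSourceField μ hg hg_supp x)]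
  simp only [ray, integral_const, ← area_def, smul_smul, mul_inv_cancel₀ area_ne_zero, one_smul]

end PointSource

section DivFree

theorem exists_seq_contDiff_cutoff (E : Type*) [NormedAddCommGroup E] [NormedSpace ℝ E]
    [FiniteDimensional ℝ E] :
    ∃ (χ : ℕ → E → ℝ) (c : ℕ → ℝ), (∀ n, ContDiff ℝ ∞ (χ n)) ∧ (∀ n, HasCompactSupport (χ n)) ∧
      (∀ n x, ‖χ n x‖ ≤ 1) ∧ (∀ x, Tendsto (χ · x) atTop (𝓝 1)) ∧
      (∀ n x, ‖fderiv ℝ (χ n) x‖ ≤ c n) ∧ Tendsto c atTop (𝓝 0) := by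
  let χ : ContDiffBump (0 : E) := ⟨1, 2, one_pos, one_lt_two⟩
  obtain ⟨M, hM⟩ := ((χ.contDiff (n := 1)).continuous_fderiv
    one_ne_zero).bounded_above_of_compact_support (χ.hasCompactSupport.fderiv ℝ)
  have scale : Tendsto (fun n : ℕ => 1 / ((n : ℝ) + 1)) atTop (𝓝 0) :=
    tendsto_one_div_add_atTop_nhds_zero_nat
  refine ⟨fun n x => χ ((1 / ((n : ℝ) + 1)) • x), fun n => 1 / ((n : ℝ) + 1) * M,
    fun n => χ.contDiff.comp (contDiff_id.const_smul _),
    fun n => χ.hasCompactSupport.comp_smul (by positivity), fun n x => ?_, fun x => ?_,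
    fun n x => ?_, by simpa using scale.mul_const M⟩
  · rw [Real.norm_of_nonneg χ.nonneg]
    exact χ.le_one
  · have lim := (χ.continuous.tendsto _).comp (scale.smul_const x)
    rwa [zero_smul, χ.one_of_mem_closedBall (by simp [χ])] at lim
  · rw [fderiv_comp_smul, norm_smul, Real.norm_of_nonneg (by positivity)]
    exact mul_le_mul_of_nonneg_left (hM _) (by positivity)

variable {E : Type*} [NormedAddCommGroup E] [NormedSpace ℝ E] [FiniteDimensional ℝ E]
  [MeasurableSpace E] [BorelSpace E]

/-- The field `C` is divergence free in the sense of distributions. -/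
def IsWeaklyDivFree (μ : Measure E) (C : E → E) : Prop :=
  ∀ g : E → ℝ, ContDiff ℝ ∞ g → HasCompactSupport g → ∫ x, fderiv ℝ g x (C x) ∂μ = 0

theorem IsWeaklyDivFree.integral_fderiv_apply_eq_zero {μ : Measure E} {C : E → E}
    (h : IsWeaklyDivFree μ C) {g : E → ℝ} (hg : ContDiff ℝ ∞ g)
    (hgC : Integrable (fun x => g x • C x) μ) (hdgC : Integrable (fun x => fderiv ℝ g x (C x)) μ) :
    ∫ x, fderiv ℝ g x (C x) ∂μ = 0 := by
  obtain ⟨χ, c, hχ, hχ_supp, hχ_le, hχ_lim, hdχ, hc⟩ := exists_seq_contDiff_cutoff E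
  have main : Tendsto (fun n => ∫ x, χ n x * fderiv ℝ g x (C x) ∂μ) atTop
      (𝓝 (∫ x, fderiv ℝ g x (C x) ∂μ)) := by
    refine tendsto_integral_of_dominated_convergence _ (fun n =>
      (hχ n).continuous.aestronglyMeasurable.mul hdgC.1) hdgC.norm (fun n => .of_forall fun x => ?_)
      (.of_forall fun x => by simpa using (hχ_lim x).mul_const (fderiv ℝ g x (C x)))
    rw [norm_mul]
    exact mul_le_of_le_one_left (norm_nonneg _) (hχ_le n x)
  have integrable_main (n : ℕ) : Integrable (fun x => χ n x * fderiv ℝ g x (C x)) μ :=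
    hdgC.bdd_mul (hχ n).continuous.aestronglyMeasurable (.of_forall (hχ_le n))
  have error_le (n : ℕ) (x : E) : ‖fderiv ℝ (χ n) x (g x • C x)‖ ≤ c n * ‖g x • C x‖ :=
    (fderiv ℝ (χ n) x).le_of_opNorm_le (hdχ n x) _
  have integrable_error (n : ℕ) : Integrable (fun x => fderiv ℝ (χ n) x (g x • C x)) μ :=
    (hgC.norm.const_mul (c n)).mono' ((ContinuousLinearMap.id ℝ _).aestronglyMeasurable_comp₂
      ((hχ n).continuous_fderiv (by simp)).aestronglyMeasurable hgC.1) (.of_forall (error_le n))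
  have error : Tendsto (fun n => ∫ x, fderiv ℝ (χ n) x (g x • C x) ∂μ) atTop (𝓝 0) := by
    refine squeeze_zero_norm (fun n => norm_integral_le_of_norm_le (hgC.norm.const_mul (c n))
      (.of_forall (error_le n))) ?_
    simpa [integral_const_mul] using hc.mul_const (∫ x, ‖g x • C x‖ ∂μ)
  have leibniz (n : ℕ) (x : E) : fderiv ℝ (fun y => χ n y * g y) x (C x) =
      χ n x * fderiv ℝ g x (C x) + fderiv ℝ (χ n) x (g x • C x) := by
    rw [fderiv_fun_mul ((hχ n).differentiable (by simp) x) (hg.differentiable (by simp) x)]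
    simp
  have sum_eq_zero (n : ℕ) :
      ∫ x, χ n x * fderiv ℝ g x (C x) ∂μ + ∫ x, fderiv ℝ (χ n) x (g x • C x) ∂μ = 0 := by
    rw [← integral_add (integrable_main n) (integrable_error n)]
    simp only [← leibniz]
    exact h _ ((hχ n).mul hg) (hχ_supp n).mul_right
  have lim := main.add error
  simp only [sum_eq_zero, add_zero] at lim
  exact tendsto_nhds_unique lim tendsto_const_nhds

end DivFree

section DivFreePotential

open Module
open scoped Convolution InnerProductSpace

theorem integrable_prod_pointSourceField {E F H : Type*} [NormedAddCommGroup E] [NormedSpace ℝ E]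
    [FiniteDimensional ℝ E] [Nontrivial E] [MeasurableSpace E] [BorelSpace E]
    [NormedAddCommGroup F] [NormedAddCommGroup H] {μ : Measure E} [μ.IsAddHaarMeasure]
    {p q : ℝ≥0∞} [p.HolderConjugate q] (hq : q ≠ ⊤)
    (hdq : finrank ℝ E < (finrank ℝ E - 1) * q.toReal) {C : E → F} (hC : MemLp C p μ) {h : E → H}
    (hh : Continuous h) (hh_supp : HasCompactSupport h) :
    Integrable (fun z : E × E => ‖C z.2‖ * (‖h z.1‖ * ‖pointSourceField μ (z.1 - z.2)‖))
      (μ.prod μ) := by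
  have : q.HolderConjugate p := ENNReal.HolderConjugate.symm
  have hq₁ : 1 ≤ q := ENNReal.HolderConjugate.one_le q p
  have near : MemLp ((Metric.ball 0 1).indicator (pointSourceField μ)) 1 μ :=
    (memLp_indicator_iff_restrict measurableSet_ball).2 <|
      memLp_pointSourceField_ball μ one_ne_zero ENNReal.one_ne_top (by simp) one_pos
  have far : MemLp ((Metric.ball 0 1)ᶜ.indicator (pointSourceField μ)) q μ :=
    (memLp_indicator_iff_restrict measurableSet_ball.compl).2 <|
      memLp_pointSourceField_compl_ball μ (one_pos.trans_le hq₁).ne' hq hdq one_pos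
  have hh' (s : ℝ≥0∞) : MemLp h s μ := hh.memLp_of_hasCompactSupport hh_supp
  refine ((integrable_prod_convolution_integrand hq₁ le_rfl hq (by simp [add_comm]) hC near
    (hh' q)).add (integrable_prod_convolution_integrand le_rfl hq₁ hq (by simp) hC far
    (hh' 1))).congr (.of_forall fun z => ?_)
  rcases lt_or_ge ‖z.1 - z.2‖ 1 with hz | hz
  · simp [Set.indicator, hz, hz.not_ge]
  · simp [Set.indicator, hz, hz.not_gt]

variable {E : Type*} [NormedAddCommGroup E] [InnerProductSpace ℝ E] [FiniteDimensional ℝ E]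
  [MeasurableSpace E] [BorelSpace E] {μ : Measure E} [Nontrivial E] [μ.IsAddHaarMeasure]
  {Φ : E → E}

theorem integral_inner_pointSourceField_fderiv (hΦ : ContDiff ℝ 1 Φ)
    (hΦ_supp : HasCompactSupport Φ) (t c : E) :
    ∫ x, ⟪pointSourceField μ (x - t), fderiv ℝ Φ x c⟫_ℝ ∂μ =
      -fderiv ℝ (pointSourceField μ ⋆[innerSL ℝ, μ] Φ) t c := by
  rw [(hΦ_supp.hasFDerivAt_convolution_right (innerSL ℝ) (locallyIntegrable_pointSourceField μ) hΦ
      t).fderiv, convolution_precompR_apply _ (locallyIntegrable_pointSourceField μ)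
      (hΦ_supp.fderiv ℝ) (hΦ.continuous_fderiv one_ne_zero), convolution_def, ← integral_neg,
    ← integral_sub_left_eq_self _ μ t]
  simp only [sub_sub_cancel_left, pointSourceField_neg, inner_neg_left]
  rfl

theorem integral_inner_fderiv_pointSourceField (hΦ : ContDiff ℝ 1 Φ)
    (hΦ_supp : HasCompactSupport Φ) (t c : E) :
    ∫ x, ⟪c, fderiv ℝ Φ x (pointSourceField μ (x - t))⟫_ℝ ∂μ = -⟪c, Φ t⟫_ℝ := by
  rw [← integral_fderiv_pointSourceField μ hΦ hΦ_supp t,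
    ← integral_inner (integrable_fderiv_pointSourceField μ hΦ hΦ_supp t) c, ← integral_neg,
    ← integral_sub_left_eq_self _ μ t]
  simp [pointSourceField_neg]

variable {C : E → E} {p q : ℝ≥0∞} [p.HolderConjugate q]

theorem integrable_prod_inner_pointSourceField_fderiv (hq : q ≠ ⊤)
    (hdq : finrank ℝ E < (finrank ℝ E - 1) * q.toReal) (hC : MemLp C p μ) (hΦ : ContDiff ℝ 1 Φ)
    (hΦ_supp : HasCompactSupport Φ) :
    Integrable (fun z : E × E => ⟪pointSourceField μ (z.1 - z.2), fderiv ℝ Φ z.1 (C z.2)⟫_ℝ)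
      (μ.prod μ) := by
  have hdΦ := hΦ.continuous_fderiv one_ne_zero
  refine (integrable_prod_pointSourceField hq hdq hC hdΦ (hΦ_supp.fderiv ℝ)).mono' ?_
    (.of_forall fun z => ?_)
  · exact (measurable_pointSourceField μ |>.comp measurable_sub).aestronglyMeasurable.inner
      ((ContinuousLinearMap.id ℝ _).aestronglyMeasurable_comp₂
        (hdΦ.comp continuous_fst).aestronglyMeasurable hC.1.comp_snd)
  · calc _ ≤ ‖pointSourceField μ (z.1 - z.2)‖ * (‖fderiv ℝ Φ z.1‖ * ‖C z.2‖) :=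
          (norm_inner_le_norm _ _).trans (by gcongr; exact ContinuousLinearMap.le_opNorm _ _)
      _ = _ := by ring

theorem integrable_prod_inner_fderiv_pointSourceField (hq : q ≠ ⊤)
    (hdq : finrank ℝ E < (finrank ℝ E - 1) * q.toReal) (hC : MemLp C p μ) (hΦ : ContDiff ℝ 1 Φ)
    (hΦ_supp : HasCompactSupport Φ) :
    Integrable (fun z : E × E => ⟪C z.2, fderiv ℝ Φ z.1 (pointSourceField μ (z.1 - z.2))⟫_ℝ)
      (μ.prod μ) := by
  have hdΦ := hΦ.continuous_fderiv one_ne_zero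
  refine (integrable_prod_pointSourceField hq hdq hC hdΦ (hΦ_supp.fderiv ℝ)).mono' ?_
    (.of_forall fun z => ?_)
  · exact hC.1.comp_snd.inner ((ContinuousLinearMap.id ℝ _).aestronglyMeasurable_comp₂
      (hdΦ.comp continuous_fst).aestronglyMeasurable
      (measurable_pointSourceField μ |>.comp measurable_sub).aestronglyMeasurable)
  · exact (norm_inner_le_norm _ _).trans (by gcongr; exact ContinuousLinearMap.le_opNorm _ _)

theorem IsWeaklyDivFree.integral_fderiv_convolution_pointSourceField (h : IsWeaklyDivFree μ C)
    (hq : q ≠ ⊤) (hdq : finrank ℝ E < (finrank ℝ E - 1) * q.toReal) (hC : MemLp C p μ)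
    (hΦ : ContDiff ℝ ∞ Φ) (hΦ_supp : HasCompactSupport Φ) :
    ∫ t, fderiv ℝ (pointSourceField μ ⋆[innerSL ℝ, μ] Φ) t (C t) ∂μ = 0 := by
  have hΦ₁ : ContDiff ℝ 1 Φ := hΦ.of_le (by simp)
  refine h.integral_fderiv_apply_eq_zero
    (hΦ_supp.contDiff_convolution_right _ (locallyIntegrable_pointSourceField μ) hΦ) ?_ ?_
  · have integrable_prod : Integrable
        (fun z : E × E => ⟪pointSourceField μ (z.1 - z.2), Φ z.1⟫_ℝ • C z.2) (μ.prod μ) := by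
      refine (integrable_prod_pointSourceField hq hdq hC hΦ.continuous hΦ_supp).mono' ?_
        (.of_forall fun z => ?_)
      · exact ((measurable_pointSourceField μ |>.comp
          measurable_sub).aestronglyMeasurable.inner
          (hΦ.continuous.comp continuous_fst).aestronglyMeasurable).smul hC.1.comp_snd
      · calc _ ≤ ‖pointSourceField μ (z.1 - z.2)‖ * ‖Φ z.1‖ * ‖C z.2‖ := by
              rw [norm_smul]
              gcongr
              exact norm_inner_le_norm _ _
          _ = _ := by ring
    refine integrable_prod.integral_prod_right.neg.congr (.of_forall fun t => ?_)
    simp only [Pi.neg_apply]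
    rw [integral_smul_const, ← neg_smul, ← integral_neg, ← integral_sub_left_eq_self _ μ t]
    simp only [sub_sub_cancel_left, pointSourceField_neg, inner_neg_left, neg_neg]
    rfl
  · refine (integrable_prod_inner_pointSourceField_fderiv hq hdq hC hΦ₁
      hΦ_supp).integral_prod_right.neg.congr (.of_forall fun t => ?_)
    simp only [Pi.neg_apply, integral_inner_pointSourceField_fderiv hΦ₁ hΦ_supp, neg_neg]

-- The weak form of "the curl of the Biot–Savart field of `C` is `C`", valid in every dimension.
theorem IsWeaklyDivFree.integral_integral_inner_pointSourceField_sub (h : IsWeaklyDivFree μ C)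
    (hq : q ≠ ⊤) (hdq : finrank ℝ E < (finrank ℝ E - 1) * q.toReal) (hC : MemLp C p μ)
    (hΦ : ContDiff ℝ ∞ Φ) (hΦ_supp : HasCompactSupport Φ) :
    ∫ x, ∫ t, (⟪pointSourceField μ (x - t), fderiv ℝ Φ x (C t)⟫_ℝ -
      ⟪C t, fderiv ℝ Φ x (pointSourceField μ (x - t))⟫_ℝ) ∂μ ∂μ = ∫ t, ⟪C t, Φ t⟫_ℝ ∂μ := by
  have hΦ₁ : ContDiff ℝ 1 Φ := hΦ.of_le (by simp)
  have I₁ := integrable_prod_inner_pointSourceField_fderiv hq hdq hC hΦ₁ hΦ_supp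
  have I₂ := integrable_prod_inner_fderiv_pointSourceField hq hdq hC hΦ₁ hΦ_supp
  calc _ = ∫ t, ∫ x, ⟪pointSourceField μ (x - t), fderiv ℝ Φ x (C t)⟫_ℝ ∂μ ∂μ -
        ∫ t, ∫ x, ⟪C t, fderiv ℝ Φ x (pointSourceField μ (x - t))⟫_ℝ ∂μ ∂μ := by
        rw [integral_integral (I₁.sub I₂), integral_sub I₁ I₂, integral_prod_symm _ I₁,
          integral_prod_symm _ I₂]
    _ = -∫ t, fderiv ℝ (pointSourceField μ ⋆[innerSL ℝ, μ] Φ) t (C t) ∂μ +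
        ∫ t, ⟪C t, Φ t⟫_ℝ ∂μ := by
        simp only [integral_inner_pointSourceField_fderiv hΦ₁ hΦ_supp,
          integral_inner_fderiv_pointSourceField hΦ₁ hΦ_supp, integral_neg, sub_neg_eq_add]
    _ = ∫ t, ⟪C t, Φ t⟫_ℝ ∂μ := by
        rw [h.integral_fderiv_convolution_pointSourceField hq hdq hC hΦ hΦ_supp, neg_zero, zero_add]

end DivFreePotential

section Mollification

open scoped Convolution
open ContinuousLinearMap (lsmul)

variable {E V : Type*} [NormedAddCommGroup E] [NormedSpace ℝ E] [FiniteDimensional ℝ E]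
  [MeasurableSpace E] [BorelSpace E] {μ : Measure E} [μ.IsAddHaarMeasure] [NormedAddCommGroup V]
  {f : E → V}

theorem tendsto_lintegral_translate_sub (hf : Integrable f μ) :
    Tendsto (fun t => ∫⁻ x, ‖f (x - t) - f x‖ₑ ∂μ) (𝓝 0) (𝓝 0) := by
  have hf₁ : MemLp f 1 μ := memLp_one_iff_integrable.2 hf
  have : Fact ((1 : ℝ≥0∞) ≠ ⊤) := ⟨ENNReal.one_ne_top⟩
  have cont : Continuous fun t : E => DomAddAct.mk (-t) +ᵥ hf₁.toLp :=
    (DomAddAct.continuous_mk.comp continuous_neg).vadd continuous_const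
  have lim := tendsto_iff_edist_tendsto_0.1 (cont.tendsto 0)
  refine lim.congr fun t => ?_
  rw [neg_zero, DomAddAct.mk_zero, zero_vadd, DomAddAct.mk_vadd_toLp, Lp.edist_toLp_toLp,
    eLpNorm_one_eq_lintegral_enorm]
  simp [neg_add_eq_sub]

theorem tendsto_setLIntegral_translate_sub (hf : LocallyIntegrable f μ) (R : ℝ) :
    Tendsto (fun t => ∫⁻ x in Metric.ball 0 R, ‖f (x - t) - f x‖ₑ ∂μ) (𝓝 0) (𝓝 0) := by
  have hf' : Integrable ((Metric.ball 0 (R + 1)).indicator f) μ :=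
    (integrable_indicator_iff measurableSet_ball).2 <|
      (hf.integrableOn_isCompact (isCompact_closedBall 0 _)).mono_set Metric.ball_subset_closedBall
  refine tendsto_of_tendsto_of_tendsto_of_le_of_le' tendsto_const_nhds
    (tendsto_lintegral_translate_sub hf') (.of_forall fun _ => zero_le) ?_
  filter_upwards [Metric.ball_mem_nhds 0 one_pos] with t ht
  refine (setLIntegral_mono' measurableSet_ball fun x hx => ?_).trans
    (setLIntegral_le_lintegral _ _)
  rw [mem_ball_zero_iff] at ht hx
  have hx' : x ∈ Metric.ball 0 (R + 1) := by simpa using by linarith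
  have hxt : x - t ∈ Metric.ball 0 (R + 1) := by
    simpa using by linarith [norm_sub_le x t]
  rw [Set.indicator_of_mem hx', Set.indicator_of_mem hxt]

variable [NormedSpace ℝ V] [CompleteSpace V]

theorem enorm_normed_convolution_sub_le (φ : ContDiffBump (0 : E)) (hf : LocallyIntegrable f μ)
    (x : E) : ‖(φ.normed μ ⋆[lsmul ℝ ℝ, μ] f) x - f x‖ₑ ≤
      ∫⁻ t, ‖φ.normed μ t‖ₑ * ‖f (x - t) - f x‖ₑ ∂μ := by
  have integrable₁ : Integrable (fun t => φ.normed μ t • f (x - t)) μ :=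
    φ.hasCompactSupport_normed.convolutionExists_left (lsmul ℝ ℝ) φ.continuous_normed hf x
  have integrable₂ : Integrable (fun t => φ.normed μ t • f x) μ := φ.integrable_normed.smul_const _
  calc ‖(φ.normed μ ⋆[lsmul ℝ ℝ, μ] f) x - f x‖ₑ
      = ‖∫ t, φ.normed μ t • (f (x - t) - f x) ∂μ‖ₑ := by
        simp_rw [smul_sub]
        rw [integral_sub integrable₁ integrable₂, φ.integral_normed_smul, convolution_lsmul]
    _ ≤ _ := by
        simpa only [enorm_smul] using
          enorm_integral_le_lintegral_enorm fun t => φ.normed μ t • (f (x - t) - f x)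

theorem tendsto_setLIntegral_normed_convolution_sub {ι : Type*} {l : Filter ι}
    {φ : ι → ContDiffBump (0 : E)} (hφ : Tendsto (fun i => (φ i).rOut) l (𝓝 0))
    (hf : LocallyIntegrable f μ) (R : ℝ) :
    Tendsto (fun i => ∫⁻ x in Metric.ball 0 R, ‖((φ i).normed μ ⋆[lsmul ℝ ℝ, μ] f) x - f x‖ₑ ∂μ) l
      (𝓝 0) := by
  rw [ENNReal.tendsto_nhds_zero]
  intro ε hε
  obtain ⟨δ, hδ, hδε⟩ := Metric.eventually_nhds_iff.1 <|
    ENNReal.tendsto_nhds_zero.1 (tendsto_setLIntegral_translate_sub hf R) ε hε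
  filter_upwards [hφ.eventually_lt_const hδ] with i hi
  have measurable_sub : AEMeasurable (fun z : E × E => ‖(φ i).normed μ z.2‖ₑ *
      ‖f (z.1 - z.2) - f z.1‖ₑ) ((μ.restrict (Metric.ball 0 R)).prod μ) :=
    (((φ i).continuous_normed.comp continuous_snd).aestronglyMeasurable.enorm.mul
      ((hf.aestronglyMeasurable.comp_quasiMeasurePreserving
        (quasiMeasurePreserving_sub_of_right_invariant μ μ)).sub
          hf.aestronglyMeasurable.comp_fst).enorm).mono_ac <|
      Measure.restrict_le_self.absolutelyContinuous.prod .rfl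
  calc ∫⁻ x in Metric.ball 0 R, ‖((φ i).normed μ ⋆[lsmul ℝ ℝ, μ] f) x - f x‖ₑ ∂μ
      ≤ ∫⁻ x in Metric.ball 0 R, ∫⁻ t, ‖(φ i).normed μ t‖ₑ * ‖f (x - t) - f x‖ₑ ∂μ ∂μ :=
        lintegral_mono fun x => enorm_normed_convolution_sub_le (φ i) hf x
    _ = ∫⁻ t, ‖(φ i).normed μ t‖ₑ * ∫⁻ x in Metric.ball 0 R, ‖f (x - t) - f x‖ₑ ∂μ ∂μ := by
        rw [lintegral_lintegral_swap measurable_sub]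
        simp_rw [lintegral_const_mul' _ _ enorm_ne_top]
    _ ≤ ∫⁻ t, ‖(φ i).normed μ t‖ₑ * ε ∂μ := by
        refine lintegral_mono fun t => ?_
        by_cases ht : t ∈ Metric.ball 0 (φ i).rOut
        · gcongr
          exact hδε (ht.trans hi)
        · simp [Function.notMem_support.1 ((φ i).support_normed_eq (μ := μ) ▸ ht)]
    _ = ε := by
        rw [lintegral_mul_const _ (φ i).continuous_normed.measurable.enorm]
        simp_rw [Real.enorm_of_nonneg ((φ i).nonneg_normed _)]
        rw [← ofReal_integral_eq_lintegral_ofReal (φ i).integrable_normed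
          (.of_forall (φ i).nonneg_normed), (φ i).integral_normed, ENNReal.ofReal_one, one_mul]

end Mollification

section WeakDerivative

open scoped Convolution
open ContinuousLinearMap (lsmul)

theorem tendsto_integral_smul_of_tendsto_setLIntegral {E H ι : Type*} [NormedAddCommGroup E]
    [MeasurableSpace E] [BorelSpace E] [NormedAddCommGroup H] [NormedSpace ℝ H] {μ : Measure E}
    {l : Filter ι} {u : ι → E → H} {f : E → H} (hu : ∀ i, LocallyIntegrable (u i) μ)
    (hf : LocallyIntegrable f μ)
    (lim : ∀ R, Tendsto (fun i => ∫⁻ x in Metric.ball 0 R, ‖u i x - f x‖ₑ ∂μ) l (𝓝 0))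
    {g : E → ℝ} (hg : Continuous g) (hg_supp : HasCompactSupport g) :
    Tendsto (fun i => ∫ x, g x • u i x ∂μ) l (𝓝 (∫ x, g x • f x ∂μ)) := by
  obtain ⟨M, hM⟩ := hg.bounded_above_of_compact_support hg_supp
  obtain ⟨R, hR⟩ := hg_supp.isCompact.isBounded.subset_ball 0
  refine tendsto_integral_of_L1 _ (hf.integrable_smul_left_of_hasCompactSupport hg hg_supp).1
    (.of_forall fun i => (hu i).integrable_smul_left_of_hasCompactSupport hg hg_supp) ?_
  have upper := ENNReal.Tendsto.const_mul (lim R) (.inr (ENNReal.ofReal_ne_top (r := M)))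
  rw [mul_zero] at upper
  refine tendsto_of_tendsto_of_tendsto_of_le_of_le tendsto_const_nhds upper
    (fun _ => zero_le) fun i => ?_
  calc ∫⁻ x, ‖g x • u i x - g x • f x‖ₑ ∂μ
      ≤ ∫⁻ x, (Metric.ball 0 R).indicator (fun x => ENNReal.ofReal M * ‖u i x - f x‖ₑ) x ∂μ := by
        refine lintegral_mono fun x => ?_
        by_cases hx : x ∈ Metric.ball 0 R
        · rw [Set.indicator_of_mem hx, ← smul_sub, enorm_smul, ← ofReal_norm (g x)]
          gcongr
          exact hM x
        · simp [image_eq_zero_of_notMem_tsupport fun h => hx (hR h)]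
    _ = ENNReal.ofReal M * ∫⁻ x in Metric.ball 0 R, ‖u i x - f x‖ₑ ∂μ := by
        rw [lintegral_indicator measurableSet_ball, lintegral_const_mul' _ _ ENNReal.ofReal_ne_top]

variable {E H : Type*} [NormedAddCommGroup E] [NormedSpace ℝ E] [MeasurableSpace E]
  [NormedAddCommGroup H] [NormedSpace ℝ H]

/-- The `1`-form `F` is the derivative of `φ` in the sense of distributions. -/
def HasWeakFDeriv (μ : Measure E) (φ : E → H) (F : E → E →L[ℝ] H) : Prop :=
  ∀ η : E → ℝ, ContDiff ℝ ∞ η → HasCompactSupport η →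
    ∀ w, ∫ x, fderiv ℝ η x w • φ x ∂μ = -∫ x, η x • F x w ∂μ

/-- The `1`-form `F` is closed in the sense of distributions. -/
def IsWeaklyClosed (μ : Measure E) (F : E → E →L[ℝ] H) : Prop :=
  ∀ η : E → ℝ, ContDiff ℝ ∞ η → HasCompactSupport η →
    ∀ v w, ∫ x, fderiv ℝ η x v • F x w ∂μ = ∫ x, fderiv ℝ η x w • F x v ∂μ

theorem HasWeakFDeriv.congr_ae {μ : Measure E} {φ : E → H} {F G : E → E →L[ℝ] H}
    (h : HasWeakFDeriv μ φ F) (hFG : F =ᵐ[μ] G) : HasWeakFDeriv μ φ G := fun η hη hη_supp w => by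
  rw [h η hη hη_supp w, integral_congr_ae (g := fun x => η x • G x w)
    (hFG.mono fun x hx => by simp only [hx])]

theorem IsWeaklyClosed.congr_ae {μ : Measure E} {F G : E → E →L[ℝ] H} (h : IsWeaklyClosed μ F)
    (hFG : F =ᵐ[μ] G) : IsWeaklyClosed μ G := fun η hη hη_supp v w => by
  have replace_form (v w : E) : ∫ x, fderiv ℝ η x v • F x w ∂μ = ∫ x, fderiv ℝ η x v • G x w ∂μ :=
    integral_congr_ae (hFG.mono fun x hx => by simp only [hx])
  rw [← replace_form, ← replace_form, h η hη hη_supp v w]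

theorem locallyIntegrable_clm_apply {μ : Measure E} {F : E → E →L[ℝ] H}
    (hF : LocallyIntegrable F μ) (w : E) : LocallyIntegrable (fun x => F x w) μ := fun x =>
  (ContinuousLinearMap.apply ℝ H w).integrableAtFilter_comp (hF x)

variable [BorelSpace E]

theorem HasWeakFDeriv.of_tendsto {μ : Measure E} {ι : Type*} {l : Filter ι} [l.NeBot]
    {u : ι → E → H} {φ : E → H} {U : ι → E → E →L[ℝ] H} {F : E → E →L[ℝ] H}
    (h : ∀ i, HasWeakFDeriv μ (u i) (U i))
    (hu : ∀ i, LocallyIntegrable (u i) μ) (hφ : LocallyIntegrable φ μ)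
    (hU : ∀ i, LocallyIntegrable (U i) μ) (hF : LocallyIntegrable F μ)
    (lim_u : ∀ R, Tendsto (fun i => ∫⁻ x in Metric.ball 0 R, ‖u i x - φ x‖ₑ ∂μ) l (𝓝 0))
    (lim_U : ∀ R, Tendsto (fun i => ∫⁻ x in Metric.ball 0 R, ‖U i x - F x‖ₑ ∂μ) l (𝓝 0)) :
    HasWeakFDeriv μ φ F := fun η hη hη_supp w => by
  have lim_Uw (R : ℝ) :
      Tendsto (fun i => ∫⁻ x in Metric.ball 0 R, ‖U i x w - F x w‖ₑ ∂μ) l (𝓝 0) := by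
    have upper := ENNReal.Tendsto.mul_const (lim_U R) (.inr (enorm_ne_top (x := w)))
    rw [zero_mul] at upper
    refine tendsto_of_tendsto_of_tendsto_of_le_of_le tendsto_const_nhds upper
      (fun _ => zero_le) fun i => ?_
    rw [← lintegral_mul_const' _ _ enorm_ne_top]
    exact lintegral_mono fun x => (U i x - F x).le_opENorm w
  refine tendsto_nhds_unique (tendsto_integral_smul_of_tendsto_setLIntegral hu hφ lim_u
    (hη.fderiv_right (m := 0) (by simp) |>.clm_apply contDiff_const).continuous
    (hη_supp.fderiv_apply ℝ w)) ?_
  simp_rw [fun i => h i η hη hη_supp w]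
  exact (tendsto_integral_smul_of_tendsto_setLIntegral
    (fun i => locallyIntegrable_clm_apply (hU i) w) (locallyIntegrable_clm_apply hF w) lim_Uw
      hη.continuous hη_supp).neg

variable [FiniteDimensional ℝ E] {μ : Measure E} [μ.IsAddHaarMeasure]

theorem HasWeakFDeriv.of_hasFDerivAt {φ : E → H} {F : E → E →L[ℝ] H} (hF : Continuous F)
    (h : ∀ x, HasFDerivAt φ (F x) x) : HasWeakFDeriv μ φ F := fun η hη hη_supp w => by
  have hφ : Continuous φ := continuous_iff_continuousAt.2 fun x => (h x).continuousAt
  have hdη : Continuous fun x => fderiv ℝ η x w :=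
    (hη.fderiv_right (m := 0) (by simp) |>.clm_apply contDiff_const).continuous
  have hFw : Continuous fun x => F x w := hF.clm_apply continuous_const
  have by_parts := integral_smul_fderiv_eq_neg_fderiv_smul_of_integrable (μ := μ) (v := w)
    (f := η) (g := φ) ((hdη.smul hφ).integrable_of_hasCompactSupport
      (hη_supp.fderiv_apply ℝ w).smul_right)
    (by simp only [(h _).fderiv]
        exact (hη.continuous.smul hFw).integrable_of_hasCompactSupport hη_supp.smul_right)
    ((hη.continuous.smul hφ).integrable_of_hasCompactSupport hη_supp.smul_right)
    (fun x _ => hη.differentiable (by simp) x) (fun x _ => (h x).differentiableAt)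
  simp only [(h _).fderiv] at by_parts
  rw [by_parts, neg_neg]

variable [CompleteSpace H]

theorem IsWeaklyClosed.exists_hasFDerivAt_convolution {F : E → E →L[ℝ] H}
    (h : IsWeaklyClosed μ F) (hF : LocallyIntegrable F μ) {ρ : E → ℝ} (hρ : ContDiff ℝ ∞ ρ)
    (hρ_supp : HasCompactSupport ρ) :
    ∃ φ : E → H, ∀ x, HasFDerivAt φ ((ρ ⋆[lsmul ℝ ℝ, μ] F) x) x := by
  let L : ℝ →L[ℝ] (E →L[ℝ] H) →L[ℝ] E →L[ℝ] H := lsmul ℝ ℝ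
  have deriv_conv (x : E) := hρ_supp.hasFDerivAt_convolution_left L (hρ.of_le (by simp)) hF x
  have deriv_apply (x v w : E) : fderiv ℝ (ρ ⋆[L, μ] F) x v w =
      ∫ t, fderiv ℝ ρ (x - t) v • F t w ∂μ := by
    have integrable₁ := (hρ_supp.fderiv ℝ).convolutionExists_left (𝕜 := ℝ)
      (F := E →L[ℝ] E →L[ℝ] H) (L.precompL E) (hρ.continuous_fderiv (by simp)) hF x
    rw [(deriv_conv x).fderiv, convolution_def,
      ContinuousLinearMap.integral_apply integrable₁,
      ContinuousLinearMap.integral_apply (integrable₁.apply_continuousLinearMap v),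
      ← integral_sub_left_eq_self _ μ x]
    simp only [sub_sub_cancel]
    rfl
  obtain ⟨φ, hφ⟩ := convex_univ.exists_forall_hasFDerivAt_of_fderiv_symmetric isOpen_univ
    (fun x _ => (deriv_conv x).differentiableAt.differentiableWithinAt) fun x _ v w => by
      have reflect (v t : E) : fderiv ℝ (fun t => ρ (x - t)) t v = -fderiv ℝ ρ (x - t) v := by
        have := (hρ.differentiable (by simp) (x - t)).hasFDerivAt.comp t
          ((hasFDerivAt_id t).const_sub x)
        simp [HasFDerivAt.fderiv (f := fun t => ρ (x - t)) this]
      have closed := h (fun t => ρ (x - t)) (hρ.comp (contDiff_const.sub contDiff_id))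
        (hρ_supp.comp_homeomorph (Homeomorph.subLeft x)) v w
      simp only [reflect, neg_smul, integral_neg, neg_inj] at closed
      rw [deriv_apply, deriv_apply, closed]
  exact ⟨φ, fun x => hφ x trivial⟩

end WeakDerivative

section HomotopyOperator

open Module (finrank)
open scoped ProbabilityTheory
open AffineMap (lineMap)

variable {E : Type*} [NormedAddCommGroup E] [NormedSpace ℝ E] [FiniteDimensional ℝ E]
  [MeasurableSpace E] [BorelSpace E] {μ : Measure E} [μ.IsAddHaarMeasure]

theorem lintegral_comp_smul_add_le {h : E → ℝ≥0∞} (hh : Measurable h) {c : ℝ} (hc : 1 / 2 ≤ c)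
    (v : E) : ∫⁻ x, h (c • x + v) ∂μ ≤ 2 ^ finrank ℝ E * ∫⁻ x, h x ∂μ := by
  have hc₀ : 0 < c := one_half_pos.trans_le hc
  calc ∫⁻ x, h (c • x + v) ∂μ = ∫⁻ y, h (y + v) ∂(μ.map (c • ·)) :=
        (lintegral_map (hh.comp (measurable_id.add_const v)) (measurable_const_smul c)).symm
    _ = ENNReal.ofReal ((c ^ finrank ℝ E)⁻¹) * ∫⁻ x, h x ∂μ := by
        rw [Measure.map_addHaar_smul _ hc₀.ne', lintegral_smul_measure,
          lintegral_add_right_eq_self, abs_of_pos (by positivity), smul_eq_mul]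
    _ ≤ 2 ^ finrank ℝ E * ∫⁻ x, h x ∂μ := by
        gcongr
        rw [← inv_pow, ENNReal.ofReal_pow (by positivity)]
        gcongr
        rw [← ENNReal.ofReal_ofNat]
        gcongr
        exact inv_le_of_inv_le₀ two_pos (by simpa using hc)

instance isProbabilityMeasure_cond_unitBall : IsProbabilityMeasure μ[|Metric.ball 0 1] :=
  ProbabilityTheory.cond_isProbabilityMeasure_of_finite
    (Metric.measure_ball_pos μ 0 one_pos).ne' measure_ball_lt_top.ne

theorem exists_lintegral_lineMap_le (μ : Measure E) [μ.IsAddHaarMeasure] (R : ℝ) :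
    ∃ C ≠ ⊤, ∀ h : E → ℝ≥0∞, Measurable h → ∀ t : ℝ,
      ∫⁻ a, ∫⁻ x in Metric.ball 0 R, h (lineMap a x t) ∂μ ∂μ[|Metric.ball 0 1] ≤
        C * ∫⁻ x, h x ∂μ := by
  have ball_ne_zero : μ (Metric.ball 0 1) ≠ 0 := (Metric.measure_ball_pos μ 0 one_pos).ne'
  refine ⟨2 ^ finrank ℝ E * (1 + (μ (Metric.ball 0 1))⁻¹ * μ (Metric.ball 0 R)), ?_,
    fun h hh t => ?_⟩
  · finiteness
  rw [mul_add, mul_one, add_mul]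
  rcases le_total (1 / 2) t with ht | ht
  · refine le_add_right ?_
    calc ∫⁻ a, ∫⁻ x in Metric.ball 0 R, h (lineMap a x t) ∂μ ∂μ[|Metric.ball 0 1]
        ≤ ∫⁻ _, 2 ^ finrank ℝ E * ∫⁻ x, h x ∂μ ∂μ[|Metric.ball 0 1] := by
          refine lintegral_mono fun a => (setLIntegral_le_lintegral _ _).trans ?_
          simpa only [AffineMap.lineMap_apply_module, add_comm] using
            lintegral_comp_smul_add_le hh ht ((1 - t) • a)
      _ = 2 ^ finrank ℝ E * ∫⁻ x, h x ∂μ := by simp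
  · refine le_add_left ?_
    have measurable_lineMap : Measurable fun q : E × E => h (lineMap q.1 q.2 t) :=
      hh.comp (by fun_prop)
    rw [lintegral_lintegral_swap measurable_lineMap.aemeasurable]
    calc ∫⁻ x in Metric.ball 0 R, ∫⁻ a, h (lineMap a x t) ∂μ[|Metric.ball 0 1] ∂μ
        ≤ ∫⁻ _ in Metric.ball 0 R, (μ (Metric.ball 0 1))⁻¹ *
            (2 ^ finrank ℝ E * ∫⁻ x, h x ∂μ) ∂μ := by
          refine lintegral_mono fun x => ?_
          rw [ProbabilityTheory.cond, lintegral_smul_measure, smul_eq_mul]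
          gcongr
          refine (setLIntegral_le_lintegral _ _).trans ?_
          simpa only [AffineMap.lineMap_apply_module] using
            lintegral_comp_smul_add_le hh (by linarith : 1 / 2 ≤ 1 - t) (t • x)
      _ = _ := by
          rw [setLIntegral_const]
          ring

variable {H : Type*} [NormedAddCommGroup H] [NormedSpace ℝ H]

/-- The parameters of the segments used by `homotopyOp`: the starting point is uniformly
distributed in the unit ball, the position on the segment in the unit interval. -/
noncomputable abbrev segmentMeasure (μ : Measure E) : Measure (E × ℝ) :=
  μ[|Metric.ball 0 1].prod (volume.restrict (Set.Ioc 0 1))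

/-- The derivative of `t ↦ φ (lineMap a x t)` at `p = (a, t)`, for a primitive `φ` of `F`. -/
def homotopyIntegrand (F : E → E →L[ℝ] H) (x : E) (p : E × ℝ) : H :=
  F (lineMap p.1 x p.2) (x - p.1)

/-- The homotopy operator of the Poincaré lemma, averaged over the base point so that it is defined
on locally integrable `1`-forms; it inverts the derivative on closed forms. -/
noncomputable def homotopyOp (μ : Measure E) (F : E → E →L[ℝ] H) (x : E) : H :=
  ∫ p, homotopyIntegrand F x p ∂(segmentMeasure μ)

theorem stronglyMeasurable_homotopyIntegrand {F : E → E →L[ℝ] H} (hF : StronglyMeasurable F) :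
    StronglyMeasurable fun q : E × E × ℝ => homotopyIntegrand F q.1 q.2 :=
  isBoundedBilinearMap_apply.continuous.comp_stronglyMeasurable <|
    (hF.comp_measurable (by fun_prop)).prodMk (Measurable.stronglyMeasurable (by fun_prop))

theorem ae_segmentMeasure : ∀ᵐ p ∂(segmentMeasure μ), p ∈ Metric.ball (0 : E) 1 ×ˢ Set.Ioc 0 1 := by
  rw [segmentMeasure, ProbabilityTheory.cond, Measure.prod_smul_left, Measure.prod_restrict]
  exact Measure.ae_smul_measure (ae_restrict_mem (measurableSet_ball.prod measurableSet_Ioc)) _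

theorem exists_lintegral_homotopyIntegrand_le (μ : Measure E) [μ.IsAddHaarMeasure] {R : ℝ}
    (hR : 1 ≤ R) :
    ∃ C ≠ ⊤, ∀ F : E → E →L[ℝ] H, StronglyMeasurable F →
      ∫⁻ x in Metric.ball 0 R, ∫⁻ p, ‖homotopyIntegrand F x p‖ₑ ∂(segmentMeasure μ) ∂μ ≤
        C * ∫⁻ x in Metric.ball 0 R, ‖F x‖ₑ ∂μ := by
  obtain ⟨C, hC, bound⟩ := exists_lintegral_lineMap_le μ R
  refine ⟨ENNReal.ofReal (2 * R) * C, by finiteness, fun F hF => ?_⟩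
  set h : E → ℝ≥0∞ := (Metric.ball 0 R).indicator fun x => ‖F x‖ₑ with h_def
  have hh : Measurable h := hF.enorm.indicator measurableSet_ball
  have hh' : Measurable fun q : E × E × ℝ => h (lineMap q.2.1 q.1 q.2.2) := hh.comp (by fun_prop)
  have pointwise {x : E} (hx : x ∈ Metric.ball 0 R) {p : E × ℝ}
      (hp : p ∈ Metric.ball (0 : E) 1 ×ˢ Set.Ioc (0 : ℝ) 1) :
      ‖homotopyIntegrand F x p‖ₑ ≤ ENNReal.ofReal (2 * R) * h (lineMap p.1 x p.2) := by
    have ha : p.1 ∈ Metric.ball (0 : E) R := Metric.ball_subset_ball hR hp.1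
    rw [h_def, Set.indicator_of_mem
      ((convex_ball (0 : E) R).lineMap_mem ha hx ⟨hp.2.1.le, hp.2.2⟩), mul_comm]
    refine ((F _).le_opENorm _).trans ?_
    gcongr
    rw [mem_ball_zero_iff] at ha hx
    rw [← ofReal_norm]
    gcongr
    linarith [norm_sub_le x p.1]
  calc ∫⁻ x in Metric.ball 0 R, ∫⁻ p, ‖homotopyIntegrand F x p‖ₑ ∂(segmentMeasure μ) ∂μ
      ≤ ∫⁻ x in Metric.ball 0 R, ∫⁻ p, ENNReal.ofReal (2 * R) * h (lineMap p.1 x p.2)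
          ∂(segmentMeasure μ) ∂μ :=
        setLIntegral_mono' measurableSet_ball fun x hx =>
          lintegral_mono_ae (ae_segmentMeasure.mono fun p hp => pointwise hx hp)
    _ = ENNReal.ofReal (2 * R) * ∫⁻ t in Set.Ioc (0 : ℝ) 1,
          ∫⁻ a, ∫⁻ x in Metric.ball 0 R, h (lineMap a x t) ∂μ ∂μ[|Metric.ball 0 1] := by
        simp_rw [lintegral_const_mul' _ _ ENNReal.ofReal_ne_top]
        rw [lintegral_lintegral_swap hh'.aemeasurable,
          lintegral_prod_symm _ (Measurable.lintegral_prod_left' hh').aemeasurable]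
    _ ≤ ENNReal.ofReal (2 * R) * ∫⁻ _ in Set.Ioc (0 : ℝ) 1, C * ∫⁻ x, h x ∂μ := by
        gcongr with t
        exact bound h hh t
    _ = _ := by
        rw [h_def, lintegral_indicator measurableSet_ball]
        simp [mul_assoc]

theorem integrable_homotopyIntegrand {F : E → E →L[ℝ] H} (hF : StronglyMeasurable F)
    (hF' : LocallyIntegrable F μ) {R : ℝ} (hR : 1 ≤ R) :
    Integrable (fun q : E × E × ℝ => homotopyIntegrand F q.1 q.2)
      ((μ.restrict (Metric.ball 0 R)).prod (segmentMeasure μ)) := by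
  have measurable := stronglyMeasurable_homotopyIntegrand hF
  refine ⟨measurable.aestronglyMeasurable, ?_⟩
  obtain ⟨C, hC, bound⟩ := exists_lintegral_homotopyIntegrand_le (H := H) μ hR
  rw [hasFiniteIntegral_iff_enorm, lintegral_prod _ measurable.enorm.aemeasurable]
  refine (bound F hF).trans_lt (ENNReal.mul_lt_top hC.lt_top ?_)
  exact ((hF'.integrableOn_isCompact (isCompact_closedBall 0 R)).mono_set
    Metric.ball_subset_closedBall).2

theorem locallyIntegrable_homotopyOp {F : E → E →L[ℝ] H} (hF : StronglyMeasurable F)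
    (hF' : LocallyIntegrable F μ) : LocallyIntegrable (homotopyOp μ F) μ := fun x =>
  ⟨Metric.ball 0 (‖x‖ + 1), Metric.isOpen_ball.mem_nhds (by simp),
    (integrable_homotopyIntegrand hF hF' (by linarith [norm_nonneg x])).integral_prod_left⟩

theorem exists_setLIntegral_homotopyOp_sub_le (μ : Measure E) [μ.IsAddHaarMeasure] {R : ℝ}
    (hR : 1 ≤ R) :
    ∃ C ≠ ⊤, ∀ F G : E → E →L[ℝ] H, StronglyMeasurable F → StronglyMeasurable G →
      LocallyIntegrable F μ → LocallyIntegrable G μ →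
      ∫⁻ x in Metric.ball 0 R, ‖homotopyOp μ F x - homotopyOp μ G x‖ₑ ∂μ ≤
        C * ∫⁻ x in Metric.ball 0 R, ‖F x - G x‖ₑ ∂μ := by
  obtain ⟨C, hC, bound⟩ := exists_lintegral_homotopyIntegrand_le (H := H) μ hR
  refine ⟨C, hC, fun F G hF hG hF' hG' => le_trans (lintegral_mono_ae ?_) (bound _ (hF.sub hG))⟩
  filter_upwards [(integrable_homotopyIntegrand hF hF' hR).prod_right_ae,
    (integrable_homotopyIntegrand hG hG' hR).prod_right_ae] with x hFx hGx
  rw [homotopyOp, homotopyOp, ← integral_sub hFx hGx]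
  exact enorm_integral_le_lintegral_enorm _

theorem tendsto_setLIntegral_homotopyOp_sub {ι : Type*} {l : Filter ι}
    {u : ι → E → E →L[ℝ] H} {F : E → E →L[ℝ] H} (hu : ∀ i, StronglyMeasurable (u i))
    (hu' : ∀ i, LocallyIntegrable (u i) μ) (hF : StronglyMeasurable F)
    (hF' : LocallyIntegrable F μ)
    (lim : ∀ R, Tendsto (fun i => ∫⁻ x in Metric.ball 0 R, ‖u i x - F x‖ₑ ∂μ) l (𝓝 0)) (R : ℝ) :
    Tendsto (fun i => ∫⁻ x in Metric.ball 0 R, ‖homotopyOp μ (u i) x - homotopyOp μ F x‖ₑ ∂μ) l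
      (𝓝 0) := by
  obtain ⟨C, hC, bound⟩ := exists_setLIntegral_homotopyOp_sub_le (H := H) μ (le_max_right R 1)
  have upper := ENNReal.Tendsto.const_mul (lim (max R 1)) (.inr hC)
  rw [mul_zero] at upper
  exact tendsto_of_tendsto_of_tendsto_of_le_of_le tendsto_const_nhds upper (fun _ => zero_le)
    fun i => (lintegral_mono_set (Metric.ball_subset_ball (le_max_left R 1))).trans
      (bound _ _ (hu i) hF (hu' i) hF')

variable [CompleteSpace H]

theorem integral_homotopyIntegrand_eq_sub {E : Type*} [NormedAddCommGroup E] [NormedSpace ℝ E]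
    {F : E → E →L[ℝ] H} (hF : Continuous F) {φ : E → H}
    (hφ : ∀ x, HasFDerivAt φ (F x) x) (x a : E) :
    ∫ t in Set.Ioc (0 : ℝ) 1, homotopyIntegrand F x (a, t) = φ x - φ a := by
  have deriv_lineMap (t : ℝ) : HasDerivAt (fun t => φ (lineMap a x t))
      (homotopyIntegrand F x (a, t)) t :=
    (hφ _).comp_hasDerivAt t AffineMap.hasDerivAt_lineMap
  have continuous_integrand : Continuous fun t => homotopyIntegrand F x (a, t) :=
    (hF.comp (by fun_prop)).clm_apply (by fun_prop)
  rw [← intervalIntegral.integral_of_le zero_le_one,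
    intervalIntegral.integral_eq_sub_of_hasDerivAt (fun t _ => deriv_lineMap t)
      (continuous_integrand.intervalIntegrable _ _), AffineMap.lineMap_apply_one,
    AffineMap.lineMap_apply_zero]

theorem homotopyOp_eq_sub_integral {F : E → E →L[ℝ] H} (hF : Continuous F) {φ : E → H}
    (hφ : ∀ x, HasFDerivAt φ (F x) x) (x : E) :
    homotopyOp μ F x = φ x - ∫ a, φ a ∂μ[|Metric.ball 0 1] := by
  have ball_ne_zero : μ (Metric.ball 0 1) ≠ 0 := (Metric.measure_ball_pos μ 0 one_pos).ne'
  have integrable_of_continuous {g : E × ℝ → H} (hg : Continuous g) :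
      Integrable g (segmentMeasure μ) := by
    rw [segmentMeasure, ProbabilityTheory.cond, Measure.prod_smul_left, Measure.prod_restrict]
    refine Integrable.smul_measure ?_ (by simp [ball_ne_zero])
    exact (hg.continuousOn.integrableOn_compact
      ((isCompact_closedBall 0 1).prod isCompact_Icc)).mono_set
        (Set.prod_mono Metric.ball_subset_closedBall Set.Ioc_subset_Icc_self)
  have continuous_φ : Continuous φ := continuous_iff_continuousAt.2 fun x => (hφ x).continuousAt
  have integrable_φ : Integrable φ μ[|Metric.ball 0 1] :=
    ((continuous_φ.continuousOn.integrableOn_compact (isCompact_closedBall 0 1)).mono_set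
      Metric.ball_subset_closedBall).smul_measure (by simp [ball_ne_zero])
  have integrable_integrand : Integrable (homotopyIntegrand F x) (segmentMeasure μ) :=
    integrable_of_continuous ((hF.comp (by fun_prop)).clm_apply (by fun_prop))
  rw [homotopyOp, integral_prod _ integrable_integrand]
  simp_rw [integral_homotopyIntegrand_eq_sub hF hφ x]
  rw [integral_sub (integrable_const _) integrable_φ]
  simp

theorem hasWeakFDeriv_homotopyOp_of_hasFDerivAt {F : E → E →L[ℝ] H} (hF : Continuous F)
    {φ : E → H} (hφ : ∀ x, HasFDerivAt φ (F x) x) : HasWeakFDeriv μ (homotopyOp μ F) F :=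
  .of_hasFDerivAt hF fun x => by
    simpa only [funext fun x => homotopyOp_eq_sub_integral (μ := μ) hF hφ x] using
      (hφ x).sub_const _

end HomotopyOperator

section PoincareLemma

open scoped Convolution
open ContinuousLinearMap (lsmul)

variable {E H : Type*} [NormedAddCommGroup E] [NormedSpace ℝ E] [FiniteDimensional ℝ E]
  [MeasurableSpace E] [BorelSpace E] {μ : Measure E} [μ.IsAddHaarMeasure] [NormedAddCommGroup H]
  [NormedSpace ℝ H] [CompleteSpace H]

theorem IsWeaklyClosed.hasWeakFDeriv_homotopyOp {F : E → E →L[ℝ] H} (h : IsWeaklyClosed μ F)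
    (hF : StronglyMeasurable F) (hF' : LocallyIntegrable F μ) :
    HasWeakFDeriv μ (homotopyOp μ F) F := by
  let ρ (k : ℕ) : ContDiffBump (0 : E) :=
    ⟨1 / (k + 1) / 2, 1 / (k + 1), by positivity, half_lt_self (by positivity)⟩
  let U (k : ℕ) : E → E →L[ℝ] H := (ρ k).normed μ ⋆[lsmul ℝ ℝ, μ] F
  have continuous_U (k : ℕ) : Continuous (U k) :=
    (ρ k).hasCompactSupport_normed.continuous_convolution_left _ (ρ k).continuous_normed hF'
  have lim_U (R : ℝ) :
      Tendsto (fun k => ∫⁻ x in Metric.ball 0 R, ‖U k x - F x‖ₑ ∂μ) atTop (𝓝 0) :=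
    tendsto_setLIntegral_normed_convolution_sub (φ := ρ)
      tendsto_one_div_add_atTop_nhds_zero_nat hF' R
  have hU (k : ℕ) := (continuous_U k).stronglyMeasurable
  have hU' (k : ℕ) := (continuous_U k).locallyIntegrable (μ := μ)
  refine .of_tendsto (fun k => ?_) (fun k => locallyIntegrable_homotopyOp (hU k) (hU' k))
    (locallyIntegrable_homotopyOp hF hF') hU' hF'
    (tendsto_setLIntegral_homotopyOp_sub hU hU' hF hF' lim_U) lim_U
  obtain ⟨φ, hφ⟩ := h.exists_hasFDerivAt_convolution hF'
    ((ρ k).contDiff_normed (μ := μ)) (ρ k).hasCompactSupport_normed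
  exact hasWeakFDeriv_homotopyOp_of_hasFDerivAt (continuous_U k) hφ

theorem IsWeaklyClosed.exists_hasWeakFDeriv {F : E → E →L[ℝ] H} (h : IsWeaklyClosed μ F)
    (hF : LocallyIntegrable F μ) : ∃ φ, LocallyIntegrable φ μ ∧ HasWeakFDeriv μ φ F := by
  have ae_eq_mk := hF.aestronglyMeasurable.ae_eq_mk
  have measurable_mk := hF.aestronglyMeasurable.stronglyMeasurable_mk
  have hF' := hF.congr ae_eq_mk
  exact ⟨_, locallyIntegrable_homotopyOp measurable_mk hF',
    ((h.congr_ae ae_eq_mk).hasWeakFDeriv_homotopyOp measurable_mk hF').congr_ae ae_eq_mk.symm⟩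

end PoincareLemma

section Curl

theorem partialDeriv_apply {Φ : E3 → E3} {x : E3} (hΦ : DifferentiableAt ℝ Φ x) (i j : Fin 3) :
    partialDeriv i (fun y => Φ y j) x = fderiv ℝ Φ x (EuclideanSpace.single i 1) j := by
  have h : HasFDerivAt (fun y => Φ y j) (EuclideanSpace.proj j ∘L fderiv ℝ Φ x) x :=
    (EuclideanSpace.proj j : E3 →L[ℝ] ℝ).hasFDerivAt.comp x hΦ.hasFDerivAt
  rw [partialDeriv, h.fderiv]
  rfl

theorem partialDeriv_comm {g : E3 → ℝ} (hg : ContDiff ℝ 2 g) (i j : Fin 3) (x : E3) :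
    partialDeriv i (partialDeriv j g) x = partialDeriv j (partialDeriv i g) x := by
  have partial_partial (a b : Fin 3) : partialDeriv a (partialDeriv b g) x =
      fderiv ℝ (fderiv ℝ g) x (EuclideanSpace.single a 1) (EuclideanSpace.single b 1) := by
    unfold partialDeriv
    rw [fderiv_clm_apply ((hg.fderiv_right (m := 1) le_rfl).differentiable one_ne_zero x)
      (differentiableAt_const _)]
    simp
  rw [partial_partial, partial_partial]
  exact (hg.contDiffAt.isSymmSndFDerivAt (by simp)).eq _ _

theorem gradient_apply (g : E3 → ℝ) (x : E3) (i : Fin 3) :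
    gradient g x i = partialDeriv i g x := by
  rw [partialDeriv, ← inner_gradient_left, EuclideanSpace.inner_single_right]
  simp

theorem curl_gradient {g : E3 → ℝ} (hg : ContDiff ℝ 2 g) (x : E3) : curl (gradient g) x = 0 := by
  ext i
  fin_cases i <;> simp [curl, gradient_apply, partialDeriv_comm hg]

theorem continuous_curl {Φ : E3 → E3} (hΦ : ContDiff ℝ 1 Φ) : Continuous (curl Φ) := by
  have h (i j : Fin 3) : Continuous fun x => partialDeriv i (fun y => Φ y j) x :=
    ((contDiff_euclidean.1 hΦ j).continuous_fderiv one_ne_zero).clm_apply continuous_const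
  refine (PiLp.continuous_toLp 2 _).comp (continuous_pi fun i => ?_)
  fin_cases i
  exacts [(h 1 2).sub (h 2 1), (h 2 0).sub (h 0 2), (h 0 1).sub (h 1 0)]

theorem hasCompactSupport_curl {Φ : E3 → E3} (hΦ : HasCompactSupport Φ) :
    HasCompactSupport (curl Φ) := by
  refine hΦ.mono' fun x hx => ?_
  contrapose! hx
  have fderiv_eq_zero (j : Fin 3) : fderiv ℝ (fun y => Φ y j) x = 0 :=
    fderiv_of_notMem_tsupport ℝ fun h => hx <|
      closure_mono (Function.support_comp_subset (g := fun v : E3 => v j) rfl Φ) h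
  rw [Function.notMem_support]
  ext i
  fin_cases i <;> simp [curl, partialDeriv, fderiv_eq_zero]

/-- The cross product on `ℝ³`, as a continuous bilinear map. -/
noncomputable def crossL : E3 →L[ℝ] E3 →L[ℝ] E3 :=
  ((crossProduct.compl₁₂ (WithLp.linearEquiv 2 ℝ (Fin 3 → ℝ)).toLinearMap
    (WithLp.linearEquiv 2 ℝ (Fin 3 → ℝ)).toLinearMap).compr₂
      (WithLp.linearEquiv 2 ℝ (Fin 3 → ℝ)).symm.toLinearMap).toContinuousBilinearMap

theorem crossL_apply (a b : E3) :
    crossL a b = !₂[a 1 * b 2 - a 2 * b 1, a 2 * b 0 - a 0 * b 2, a 0 * b 1 - a 1 * b 0] := by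
  simp [crossL, cross_apply]

theorem inner_crossL_curl {Φ : E3 → E3} {x : E3} (hΦ : DifferentiableAt ℝ Φ x) (a b : E3) :
    inner ℝ (crossL a b) (curl Φ x) =
      inner ℝ b (fderiv ℝ Φ x a) - inner ℝ a (fderiv ℝ Φ x b) := by
  have fderiv_eq_sum (v : E3) (j : Fin 3) :
      fderiv ℝ Φ x v j = ∑ i, v i * partialDeriv i (fun y => Φ y j) x := by
    conv_lhs => rw [← (EuclideanSpace.basisFun (Fin 3) ℝ).sum_repr v]
    simp [partialDeriv_apply hΦ]
  simp only [PiLp.inner_apply, fderiv_eq_sum, crossL_apply, curl, Fin.sum_univ_three]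
  simp
  ring

theorem curl_smul_const {η : E3 → ℝ} {x : E3} (hη : DifferentiableAt ℝ η x) (a : E3) :
    curl (fun y => η y • a) x = crossL (gradient η x) a := by
  have partial_mul (i j : Fin 3) :
      partialDeriv i (fun y => η y * a j) x = partialDeriv i η x * a j := by
    simp [partialDeriv, fderiv_mul_const hη, mul_comm]
  ext i
  fin_cases i <;> simp [curl, crossL_apply, gradient_apply, partial_mul]

theorem inner_crossL_crossL (a b v w : E3) :
    inner ℝ b (crossL a (crossL v w)) =
      inner ℝ a w * inner ℝ b v - inner ℝ a v * inner ℝ b w := by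
  simp [PiLp.inner_apply, crossL_apply, Fin.sum_univ_three]
  ring

theorem HasWeakCurl.congr {A B B' : E3 → E3} (h : HasWeakCurl A B) (hB : B =ᵐ[volume] B') :
    HasWeakCurl A B' := fun Φ hΦ hΦ_supp => by
  rw [h Φ hΦ hΦ_supp, integral_congr_ae (g := fun x => inner ℝ (B' x) (Φ x))
    (hB.mono fun x hx => by simp only [hx])]

theorem integrable_inner_of_hasCompactSupport {X H : Type*} [TopologicalSpace X]
    [SecondCountableTopology X] [MeasurableSpace X] [OpensMeasurableSpace X] [T2Space X]
    [NormedAddCommGroup H] [InnerProductSpace ℝ H] {μ : Measure X} {A Ψ : X → H}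
    (hA : LocallyIntegrable A μ) (hΨ : Continuous Ψ) (hΨ_supp : HasCompactSupport Ψ) :
    Integrable (fun x => inner ℝ (A x) (Ψ x)) μ := by
  refine (hA.integrable_smul_left_of_hasCompactSupport hΨ.norm hΨ_supp.norm).mono
    (hA.aestronglyMeasurable.inner hΨ.aestronglyMeasurable) (.of_forall fun x => ?_)
  rw [norm_smul, norm_norm, mul_comm]
  exact norm_inner_le_norm _ _

theorem HasWeakCurl.sub {A A' B B' : E3 → E3} (h : HasWeakCurl A B) (h' : HasWeakCurl A' B')
    (hA : LocallyIntegrable A) (hA' : LocallyIntegrable A') (hB : LocallyIntegrable B)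
    (hB' : LocallyIntegrable B') : HasWeakCurl (A - A') (B - B') := fun Φ hΦ hΦ_supp => by
  have curl_cont : Continuous (curl Φ) := continuous_curl (hΦ.of_le (by simp))
  have curl_supp := hasCompactSupport_curl hΦ_supp
  simp only [Pi.sub_apply, inner_sub_left]
  rw [integral_sub (integrable_inner_of_hasCompactSupport hA curl_cont curl_supp)
      (integrable_inner_of_hasCompactSupport hA' curl_cont curl_supp),
    integral_sub (integrable_inner_of_hasCompactSupport hB hΦ.continuous hΦ_supp)
      (integrable_inner_of_hasCompactSupport hB' hΦ.continuous hΦ_supp), h Φ hΦ hΦ_supp,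
    h' Φ hΦ hΦ_supp]

theorem HasWeakCurl.isWeaklyDivFree {A C : E3 → E3} (h : HasWeakCurl A C) :
    IsWeaklyDivFree volume C := fun g hg hg_supp => by
  have gradient_smooth : ContDiff ℝ ∞ (gradient g) :=
    (InnerProductSpace.toDual ℝ E3).symm.contDiff.comp (hg.fderiv_right (by simp))
  have gradient_supp : HasCompactSupport (gradient g) :=
    (hg_supp.fderiv ℝ).comp_left (map_zero (InnerProductSpace.toDual ℝ E3).symm)
  have curl_eq_zero := curl_gradient (hg.of_le (WithTop.coe_le_coe.2 le_top))
  have weak_curl := h (gradient g) gradient_smooth gradient_supp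
  simp only [curl_eq_zero, inner_zero_right, integral_zero] at weak_curl
  simpa using weak_curl.symm

theorem locallyIntegrable_innerSL {F : E3 → E3} (hF : LocallyIntegrable F) :
    LocallyIntegrable fun x => innerSL ℝ (F x) := fun x =>
  (innerSL ℝ : E3 →L[ℝ] E3 →L[ℝ] ℝ).integrableAtFilter_comp (hF x)

theorem HasWeakCurl.isWeaklyClosed {F : E3 → E3} (h : HasWeakCurl F 0)
    (hF : LocallyIntegrable F) :
    IsWeaklyClosed volume fun x => innerSL ℝ (F x) := fun η hη hη_supp v w => by
  have integrable_term (a b : E3) : Integrable fun x => fderiv ℝ η x a * inner ℝ (F x) b :=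
    (locallyIntegrable_clm_apply (locallyIntegrable_innerSL hF) b)
      |>.integrable_smul_left_of_hasCompactSupport
        ((hη.continuous_fderiv (by simp)).clm_apply continuous_const) (hη_supp.fderiv_apply ℝ a)
  have weak_curl := h (fun x => η x • crossL v w) (hη.smul contDiff_const) hη_supp.smul_right
  simp only [curl_smul_const (hη.differentiable (by simp) _), inner_crossL_crossL,
    inner_gradient_left, Pi.zero_apply, inner_zero_left, integral_zero] at weak_curl
  rw [integral_sub (integrable_term _ _) (integrable_term _ _), sub_eq_zero] at weak_curl
  exact weak_curl.symm

theorem HasWeakCurl.exists_hasWeakGradOn_univ {F : E3 → E3} (h : HasWeakCurl F 0)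
    (hF : LocallyIntegrable F) :
    ∃ φ : E3 → ℝ, LocallyIntegrable φ ∧ HasWeakGradOn Set.univ φ F := by
  obtain ⟨φ, hφ, hφF⟩ := (h.isWeaklyClosed hF).exists_hasWeakFDeriv
    (locallyIntegrable_innerSL hF)
  refine ⟨φ, hφ, fun η hη hη_supp _ i => ?_⟩
  simpa [partialDeriv, mul_comm, EuclideanSpace.inner_single_right] using!
    hφF η hη hη_supp (EuclideanSpace.single i 1)

end Curl

section BiotSavart

open scoped Convolution

instance holderConjugate_three_halves_three : ENNReal.HolderConjugate (3 / 2) 3 where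
  inv_add_inv_eq_inv := by
    rw [ENNReal.inv_div (by simp) (by simp), inv_one, ← one_div, ENNReal.div_add_div_same,
      show (2 + 1 : ℝ≥0∞) = 3 by norm_num, ENNReal.div_self (by simp) (by simp)]

theorem one_le_six_fifths : (1 : ℝ≥0∞) ≤ 6 / 5 := by
  rw [ENNReal.le_div_iff_mul_le (by simp) (by simp)]
  norm_num

theorem three_halves_inv_add_six_fifths_inv :
    (3 / 2 : ℝ≥0∞)⁻¹ + (6 / 5 : ℝ≥0∞)⁻¹ = 1 + (2 : ℝ≥0∞)⁻¹ := by
  rw [← ENNReal.toReal_eq_toReal_iff' (by simp) (by simp),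
    ENNReal.toReal_add (by simp) (by simp), ENNReal.toReal_add (by simp) (by simp)]
  simp
  norm_num

/-- The Biot–Savart field of `C`, which has curl `C` when `C` is divergence free. -/
noncomputable def biotSavart (C : E3 → E3) : E3 → E3 :=
  C ⋆[crossL, volume] pointSourceField volume

/-- The part of the Biot–Savart kernel near its singularity. -/
noncomputable def nearSourceField : E3 → E3 :=
  (Metric.ball 0 1).indicator (pointSourceField volume)

/-- The part of the Biot–Savart kernel away from its singularity. -/
noncomputable def farSourceField : E3 → E3 :=
  (Metric.ball 0 1)ᶜ.indicator (pointSourceField volume)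

theorem nearSourceField_add_farSourceField :
    nearSourceField + farSourceField = pointSourceField volume :=
  Set.indicator_self_add_compl _ _

theorem memLp_nearSourceField : MemLp nearSourceField (6 / 5) :=
  (memLp_indicator_iff_restrict measurableSet_ball).2 <|
    memLp_pointSourceField_ball volume (by simp) (ENNReal.div_ne_top (by simp) (by simp))
      (by simp; norm_num) one_pos

theorem memLp_farSourceField : MemLp farSourceField 3 :=
  (memLp_indicator_iff_restrict measurableSet_ball.compl).2 <|
    memLp_pointSourceField_compl_ball volume (by simp) (by simp) (by simp; norm_num) one_pos

theorem ae_convolutionExistsAt_biotSavart {C : E3 → E3} (hC : MemLp C (3 / 2)) :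
    ∀ᵐ x, ConvolutionExistsAt C (pointSourceField volume) x crossL volume := by
  rw [← nearSourceField_add_farSourceField]
  filter_upwards [ae_convolutionExistsAt crossL fact_one_le_three_halves.out one_le_six_fifths
    (by simp) three_halves_inv_add_six_fifths_inv hC memLp_nearSourceField] with x hx
  simpa only [ConvolutionExistsAt, Pi.add_apply, map_add] using!
    hx.add (convolutionExists_of_holderConjugate crossL hC memLp_farSourceField x)

theorem locallyIntegrable_biotSavart (u : Lp E3 (3 / 2) (volume : Measure E3)) :
    LocallyIntegrable (biotSavart u) := by
  have : Fact ((1 : ℝ≥0∞) ≤ 3) := ⟨by norm_num⟩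
  have near := memLp_convolution crossL fact_one_le_three_halves.out one_le_six_fifths
    (by simp) three_halves_inv_add_six_fifths_inv (Lp.memLp u) memLp_nearSourceField
  have far : MemLp (u ⋆[crossL, volume] farSourceField) ⊤ :=
    ⟨aestronglyMeasurable_convolution crossL (Lp.aestronglyMeasurable u) memLp_farSourceField.1,
      (eLpNormEssSup_le_of_ae_enorm_bound <| .of_forall <|
        enorm_convolution_le_of_holderConjugate crossL u memLp_farSourceField).trans_lt <| by
          have := memLp_farSourceField.2
          finiteness⟩
  unfold biotSavart
  rw [← nearSourceField_add_farSourceField]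
  exact ((near.locallyIntegrable (by norm_num)).add (far.locallyIntegrable le_top)).congr
    (convolution_add_ae_eq crossL fact_one_le_three_halves.out one_le_six_fifths (by simp)
      three_halves_inv_add_six_fifths_inv (Lp.memLp u) memLp_nearSourceField
      memLp_farSourceField).symm

theorem hasWeakCurl_biotSavart {C : E3 → E3} (h : IsWeaklyDivFree volume C)
    (hC : MemLp C (3 / 2)) : HasWeakCurl (biotSavart C) C := fun Φ hΦ hΦ_supp => by
  rw [← h.integral_integral_inner_pointSourceField_sub (q := 3) (by simp) (by simp; norm_num) hC hΦ
    hΦ_supp]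
  refine integral_congr_ae ?_
  filter_upwards [ae_convolutionExistsAt_biotSavart hC] with x hx
  rw [real_inner_comm, biotSavart, convolution_def, ← integral_inner hx]
  simp only [← real_inner_comm (curl Φ x), inner_crossL_curl (hΦ.differentiable (by simp) x)]

theorem tendsto_eLpNorm_biotSavart {u : ℕ → Lp E3 (3 / 2) (volume : Measure E3)}
    (hu : Tendsto (fun n => toWeakSpace ℝ (Lp E3 (3 / 2) (volume : Measure E3)) (u n)) atTop
      (𝓝 (toWeakSpace ℝ _ 0))) {S : Set E3} (hS : volume S ≠ ⊤) :
    Tendsto (fun n => eLpNorm (biotSavart (u n)) 2 (volume.restrict S)) atTop (𝓝 0) := by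
  have : Fact ((1 : ℝ≥0∞) ≤ 3) := ⟨by norm_num⟩
  unfold biotSavart
  rw [← nearSourceField_add_farSourceField]
  exact tendsto_eLpNorm_convolution_add crossL (ENNReal.div_ne_top (by simp) (by simp))
    one_le_six_fifths (by simp) (by simp) three_halves_inv_add_six_fifths_inv hu
    memLp_nearSourceField memLp_farSourceField hS

theorem HasWeakCurl.exists_hasWeakGradOn_sub_biotSavart {D : E3 → E3}
    {C : Lp E3 (3 / 2) (volume : Measure E3)} (h : HasWeakCurl D C) (hD : LocallyIntegrable D) :
    ∃ φ : E3 → ℝ, LocallyIntegrable φ ∧ HasWeakGradOn Set.univ φ (D - biotSavart C) := by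
  have hC := (Lp.memLp C).locallyIntegrable fact_one_le_three_halves.out
  have curl_free : HasWeakCurl (D - biotSavart C) 0 := by
    simpa using h.sub (hasWeakCurl_biotSavart h.isWeaklyDivFree (Lp.memLp C)) hD
      (locallyIntegrable_biotSavart C) hC hC
  exact curl_free.exists_hasWeakGradOn_univ (hD.sub (locallyIntegrable_biotSavart C))

end BiotSavart

section GaugeSeminorm

theorem HasWeakGradOn.mono {Ω Ω' : Set E3} {φ : E3 → ℝ} {G : E3 → E3} (h : HasWeakGradOn Ω' φ G)
    (hΩ : Ω ⊆ Ω') : HasWeakGradOn Ω φ G := fun η hη hη_supp hηΩ i => by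
  have setIntegral_eq {f : E3 → ℝ} (hf : ∀ x ∉ tsupport η, f x = 0) :
      ∫ x in Ω, f x = ∫ x in Ω', f x := by
    rw [setIntegral_eq_integral_of_forall_compl_eq_zero fun x hx => hf x fun h => hx (hηΩ h),
      setIntegral_eq_integral_of_forall_compl_eq_zero fun x hx =>
        hf x fun h => hx (hΩ (hηΩ h))]
  rw [setIntegral_eq fun x hx => ?_, setIntegral_eq fun x hx => ?_]
  · exact h η hη hη_supp (hηΩ.trans hΩ) i
  · simp [image_eq_zero_of_notMem_tsupport hx]
  · simp [partialDeriv, fderiv_of_notMem_tsupport ℝ hx]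

theorem localGaugeSeminorm_le {Ω : Set E3} {F G : E3 → E3} {φ : E3 → ℝ}
    (hF : MemLp F 2 (volume.restrict Ω)) (hφ : LocallyIntegrable φ) (hG : LocallyIntegrable G)
    (hφG : HasWeakGradOn Set.univ φ G) :
    localGaugeSeminorm Ω F ≤ eLpNorm (F - G) 2 (volume.restrict Ω) := by
  rcases eq_or_ne (eLpNorm (F - G) 2 (volume.restrict Ω)) ⊤ with infinite | finite
  · exact infinite ▸ le_top
  have hFG : MemLp (F - G) 2 (volume.restrict Ω) :=
    ⟨hF.1.sub hG.aestronglyMeasurable.restrict, finite.lt_top⟩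
  exact iInf_le_of_le φ <| iInf_le_of_le G <| iInf_le _
    ⟨hφ.locallyIntegrableOn Ω, by simpa using hF.sub hFG, hφG.mono Ω.subset_univ⟩

end GaugeSeminorm

theorem proposition5_general
    (A : ℕ → E3 → E3) (A₀ : E3 → E3)
    (hA : ∀ n, LocallyIntegrable (A n) volume) (hA₀ : LocallyIntegrable A₀ volume)
    (B : ℕ → Lp E3 (3 / 2 : ℝ≥0∞) (volume : Measure E3))
    (B₀ : Lp E3 (3 / 2 : ℝ≥0∞) (volume : Measure E3))
    (hB : ∀ n, HasWeakCurl (A n) (B n)) (hB₀ : HasWeakCurl A₀ B₀)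
    (hweak : Tendsto
      (fun n => toWeakSpace ℝ (Lp E3 (3 / 2 : ℝ≥0∞) (volume : Measure E3)) (B n)) atTop
      (𝓝 (toWeakSpace ℝ (Lp E3 (3 / 2 : ℝ≥0∞) (volume : Measure E3)) B₀))) :
    ∃ (φ : ℕ → E3 → ℝ) (G : ℕ → E3 → E3),
      (∀ n, LocallyIntegrable (φ n) ∧ LocallyIntegrable (G n) ∧
        HasWeakGradOn Set.univ (φ n) (G n)) ∧
      ∀ S : Set E3, volume S < ⊤ →
        Tendsto (fun n => eLpNorm (A n - A₀ - G n) 2 (volume.restrict S)) atTop (𝓝 0) := by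
  have locallyIntegrable_Lp (u : Lp E3 (3 / 2 : ℝ≥0∞) (volume : Measure E3)) :
      LocallyIntegrable u := (Lp.memLp u).locallyIntegrable fact_one_le_three_halves.out
  have weak_curl (n : ℕ) : HasWeakCurl (A n - A₀) (B n - B₀ : Lp E3 (3 / 2) volume) :=
    ((hB n).sub hB₀ (hA n) hA₀ (locallyIntegrable_Lp _) (locallyIntegrable_Lp _)).congr
      (Lp.coeFn_sub _ _).symm
  have weak_limit : Tendsto (fun n => toWeakSpace ℝ (Lp E3 (3 / 2) volume) (B n - B₀)) atTop
      (𝓝 (toWeakSpace ℝ _ 0)) := by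
    simpa using hweak.sub_const (toWeakSpace ℝ _ B₀)
  choose φ hφ hφ_grad using fun n =>
    (weak_curl n).exists_hasWeakGradOn_sub_biotSavart ((hA n).sub hA₀)
  refine ⟨φ, _, fun n => ⟨hφ n, ((hA n).sub hA₀).sub (locallyIntegrable_biotSavart _), hφ_grad n⟩,
    fun S hS => ?_⟩
  simpa using tendsto_eLpNorm_biotSavart weak_limit hS.ne

theorem proposition5
    (A : ℕ → E3 → E3) (A₀ : E3 → E3)
    (hA : ∀ n, LocallyIntegrable (A n) volume) (hA₀ : LocallyIntegrable A₀ volume)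
    (B : ℕ → Lp E3 (3 / 2 : ℝ≥0∞) (volume : Measure E3))
    (B₀ : Lp E3 (3 / 2 : ℝ≥0∞) (volume : Measure E3))
    (hB : ∀ n, HasWeakCurl (A n) (B n)) (hB₀ : HasWeakCurl A₀ B₀)
    (hweak : Tendsto
      (fun n => toWeakSpace ℝ (Lp E3 (3 / 2 : ℝ≥0∞) (volume : Measure E3)) (B n)) atTop
      (𝓝 (toWeakSpace ℝ (Lp E3 (3 / 2 : ℝ≥0∞) (volume : Measure E3)) B₀)))
    (Ω : Set E3) (hΩ : IsOpen Ω) (hΩfin : volume Ω < ⊤)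
    (hL2 : ∀ n, MemLp (A n - A₀) 2 (volume.restrict Ω)) :
    Tendsto (fun n => localGaugeSeminorm Ω (A n - A₀)) atTop (𝓝 0) := by
  obtain ⟨φ, G, hφG, lim⟩ := proposition5_general A A₀ hA hA₀ B B₀ hB hB₀ hweak
  exact tendsto_of_tendsto_of_tendsto_of_le_of_le tendsto_const_nhds (lim Ω hΩfin)
    (fun _ => zero_le) fun n => localGaugeSeminorm_le (hL2 n) (hφG n).1 (hφG n).2.1 (hφG n).2.2
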